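/- Let $n\ge 0$ and let $f:X\to S$ be a good representative of an isolated hypersurface singularity: $f$ is holomorphic near the closed ball $B_\varepsilon\subset\mathbb C^{n+1}$, $f(0)=0$, the origin is the only critical point of $f$ in $B_\varepsilon$, every sphere $\partial B_{\varepsilon'}$ with $0<\varepsilon'\le\varepsilon$ is transverse to $f^{-1}(0)$, $\partial B_\varepsilon$ is transverse to $f^{-1}(t)$ for all $|t|\le r$, and $S=\{t\in\mathbb C: |t|\le r\}$ (with $r>0$), $X=B_\varepsilon\cap f^{-1}(S)$. Put $S^*=S\setminus\{0\}$ and $X_t=X\cap f^{-1}(t)$. Let $W\subset S^*$ be open in $\mathbb C$ (for example an open sector), and let $\delta(t)$, $t\in W$, be $n$-cycles in $X_t$ whose classes in $H_n(X_t,\mathbb Z)$ are obtained from each other by parallel transport in the $C^\infty$ fibre bundle $X\setminus X_0\to S^*$, i.e. form a locally constant family. For $t\in W$ let $\Delta(t)$ be a smooth $(n+1)$-cycle in $X\setminus X_t$ in the homology class of the tube over $\delta(t)$, which is obtained by replacing each point of $\delta(t)$ by a small circle around $X_t$ in the positive direction. Let $\eta$ be a holomorphic $n$-form on (a neighbourhood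 of) $X$, let $\omega=d\eta$, and let $b\omega=df\wedge\eta$, a representative of $b[\omega]$ for the operation $b:[d\eta]\mapsto[df\wedge\eta]$ of the Brieskorn module. Then the function $t\mapsto\int_{\Delta(t)}\frac{b\omega}{f-t}$ is complex differentiable on $W$, and for all $t\in W$ $$\frac{d}{dt}\int_{\Delta(t)}\frac{b\omega}{f-t}=\int_{\Delta(t)}\frac{\omega}{f-t}.$$ Thus $b$ acts as $\partial_t^{-1}$ on period integrals. -/

import Mathlib

noncomputable section

namespace MilnorPeriod

/-- The space `ℂ^{n+1}` with its Euclidean norm. -/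
abbrev Space (n : ℕ) : Type := EuclideanSpace ℂ (Fin (n + 1))

/-- Differential forms of type `(p, 0)` on (subsets of) `ℂ^{n+1}`. -/
abbrev DiffForm (n p : ℕ) : Type := Space n → (Space n) [⋀^Fin p]→L[ℂ] ℂ

/-! ### Good representatives of isolated singularities -/

/-- The level set of `f` through `x` is transverse at `x` to the sphere around `0` through `x`:
the real tangent space `{u | Re ⟨x, u⟩ = 0}` of the sphere and the tangent space `ker df_x`
of the level set together span `ℂ^{n+1}`. -/
def TransverseToSphereAt {n : ℕ} (f : Space n → ℂ) (x : Space n) : Prop :=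
  ∀ w : Space n, ∃ u v : Space n,
    (inner ℂ x u : ℂ).re = 0 ∧ fderiv ℂ f x v = 0 ∧ w = u + v

/-- `f` is holomorphic near the closed ball `B_ε` with `f 0 = 0`, its only critical point in `B_ε`
is `0`, all spheres `∂B_{ε'}` with `0 < ε' ≤ ε` are transverse to `f⁻¹(0)`, and `∂B_ε` is
transverse to `f⁻¹(t)` for all `|t| ≤ r`. -/
structure IsGoodRepresentative {n : ℕ} (f : Space n → ℂ) (ε r : ℝ) : Prop where
  ε_pos : 0 < ε
  r_pos : 0 < r
  analytic : AnalyticOnNhd ℂ f (Metric.closedBall 0 ε)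
  map_zero : f 0 = 0
  critical : ∀ x ∈ Metric.closedBall (0 : Space n) ε, fderiv ℂ f x = 0 ↔ x = 0
  transverse_zero : ∀ ε' : ℝ, 0 < ε' → ε' ≤ ε → ∀ x ∈ Metric.sphere (0 : Space n) ε',
    f x = 0 → TransverseToSphereAt f x
  transverse : ∀ t : ℂ, ‖t‖ ≤ r → ∀ x ∈ Metric.sphere (0 : Space n) ε,
    f x = t → TransverseToSphereAt f x

/-- The total space `X = B_ε ∩ f⁻¹(S)`, where `S` is the closed disc of radius `r`. -/
def total {n : ℕ} (f : Space n → ℂ) (ε r : ℝ) : Set (Space n) :=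
  {x | ‖x‖ ≤ ε ∧ ‖f x‖ ≤ r}

/-- The punctured disc `S* = S \ {0}`. -/
def puncturedDisc (r : ℝ) : Set ℂ := {t | t ≠ 0 ∧ ‖t‖ ≤ r}

/-- The fibre `X_t` of `f : X → S`. -/
def fibre {n : ℕ} (f : Space n → ℂ) (ε r : ℝ) (t : ℂ) : Set (Space n) :=
  {x | x ∈ total f ε r ∧ f x = t}

/-! ### Smooth singular cubical chains and integration of forms -/

/-- Singular `k`-cubes in `ℂ^{n+1}`, i.e. maps `[0,1]^k → ℂ^{n+1}`. -/
abbrev Cube (n k : ℕ) : Type := (Fin k → unitInterval) → Space n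

/-- The extension of a cube to `ℝ^k` through the projection `ℝ^k → [0,1]^k`. Only its
values on `[0,1]^k` are used below. -/
def Cube.extend {n k : ℕ} (σ : Cube n k) : (Fin k → ℝ) → Space n :=
  fun y => σ fun i => Set.projIcc (0 : ℝ) 1 zero_le_one (y i)

open scoped ContDiff in
/-- The cube is a `C^∞` map on the closed cube `[0,1]^k`. -/
def Cube.IsSmooth {n k : ℕ} (σ : Cube n k) : Prop :=
  ContDiffOn ℝ ∞ σ.extend (Set.Icc 0 1)

/-- A cube is degenerate if it does not depend on one of its coordinates. -/
def Cube.IsDegenerate {n k : ℕ} (σ : Cube n k) : Prop :=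
  ∃ i : Fin k, ∀ (y : Fin k → unitInterval) (e : unitInterval),
    σ (Function.update y i e) = σ y

/-- The face of a cube on which the `i`-th coordinate is `e`. -/
def Cube.face {n k : ℕ} (σ : Cube n (k + 1)) (i : Fin (k + 1)) (e : unitInterval) : Cube n k :=
  fun y => σ (i.insertNth e y)

/-- Integral singular cubical chains. -/
abbrev Chain (n k : ℕ) : Type := Cube n k →₀ ℤ

/-- The cubical boundary `∂σ = ∑ᵢ (-1)ⁱ (σ|_{yᵢ = 1} - σ|_{yᵢ = 0})`, the coordinates being
numbered from `0`. With this sign, Stokes' theorem reads `∫_σ dα = ∫_{∂σ} α`. -/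
def Chain.boundary {n k : ℕ} (c : Chain n (k + 1)) : Chain n k :=
  c.sum fun σ a => a • ∑ i : Fin (k + 1),
    (-1 : ℤ) ^ (i : ℕ) • (Finsupp.single (σ.face i 1) 1 - Finsupp.single (σ.face i 0) 1)

/-- The chain vanishes in the normalized complex: it is a combination of degenerate cubes. -/
def Chain.IsDegenerate {n k : ℕ} (c : Chain n k) : Prop :=
  ∀ σ ∈ c.support, Cube.IsDegenerate σ

/-- All cubes of the chain are smooth and lie in `Y`. -/
def Chain.IsSmoothIn {n k : ℕ} (c : Chain n k) (Y : Set (Space n)) : Prop :=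
  ∀ σ ∈ c.support, Cube.IsSmooth σ ∧ ∀ y, σ y ∈ Y

/-- Cycles of the normalized cubical complex (every `0`-chain is a cycle). -/
def Chain.IsCycle {n : ℕ} : {k : ℕ} → Chain n k → Prop
  | 0, _ => True
  | _ + 1, c => c.boundary.IsDegenerate

/-- `c` and `c'` differ, modulo degenerate cubes, by the boundary of a smooth chain in `Y`. -/
def Chain.Homologous {n k : ℕ} (Y : Set (Space n)) (c c' : Chain n k) : Prop :=
  ∃ e : Chain n (k + 1), e.IsSmoothIn Y ∧ (c' - c - e.boundary).IsDegenerate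

/-- The integral `∫_{[0,1]^k} σ^* α` of a form over a cube. -/
def Cube.integral {n k : ℕ} (σ : Cube n k) (α : DiffForm n k) : ℂ :=
  ∫ y in Set.Icc (0 : Fin k → ℝ) 1,
    α (σ.extend y) fun i => fderivWithin ℝ σ.extend (Set.Icc 0 1) y (Pi.single i 1)

/-- The integral `∫_c α` of a form over a chain. -/
def Chain.integral {n k : ℕ} (c : Chain n k) (α : DiffForm n k) : ℂ :=
  c.sum fun σ a => (a : ℂ) * σ.integral α

/-! ### Parallel transport and tubes -/

open scoped ContDiff in
/-- A `C^∞` trivialization of `f : X → S` over the disc of radius `ρ` around `t₀`, contained in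
`S*`, which is the identity over `t₀`: the map `(x, s) ↦ Φ x s` is a diffeomorphism from
`X_{t₀} × {|s - t₀| < ρ}` to the part of `X` over the disc, commuting with the projections to
the disc, with inverse `y ↦ (Ψ y, f y)`. As usual, a map on a subset of a Euclidean space is
smooth if it extends to a smooth map on a neighbourhood. -/
structure IsLocalTrivialization {n : ℕ} (f : Space n → ℂ) (ε r : ℝ) (t₀ : ℂ) (ρ : ℝ)
    (Φ : Space n → ℂ → Space n) (Ψ : Space n → Space n) : Prop where
  ρ_pos : 0 < ρ
  ball_subset : Metric.ball t₀ ρ ⊆ puncturedDisc r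
  smooth : ∃ V : Set (Space n × ℂ), IsOpen V ∧
    fibre f ε r t₀ ×ˢ Metric.ball t₀ ρ ⊆ V ∧ ContDiffOn ℝ ∞ (fun p => Φ p.1 p.2) V
  smooth_inv : ∃ V : Set (Space n), IsOpen V ∧
    total f ε r ∩ f ⁻¹' Metric.ball t₀ ρ ⊆ V ∧ ContDiffOn ℝ ∞ Ψ V
  mem_fibre : ∀ x ∈ fibre f ε r t₀, ∀ s ∈ Metric.ball t₀ ρ, Φ x s ∈ fibre f ε r s
  inv_mem : ∀ s ∈ Metric.ball t₀ ρ, ∀ y ∈ fibre f ε r s, Ψ y ∈ fibre f ε r t₀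
  left_inv : ∀ x ∈ fibre f ε r t₀, ∀ s ∈ Metric.ball t₀ ρ, Ψ (Φ x s) = x
  right_inv : ∀ s ∈ Metric.ball t₀ ρ, ∀ y ∈ fibre f ε r s, Φ (Ψ y) s = y
  base : ∀ x ∈ fibre f ε r t₀, Φ x t₀ = x

/-- The image of a chain under a map `ℂ^{n+1} → ℂ^{n+1}`. -/
def Chain.map {n k : ℕ} (g : Space n → Space n) (c : Chain n k) : Chain n k :=
  Finsupp.mapDomain (fun σ y => g (σ y)) c

/-- `δ` is a family of smooth `n`-cycles in the fibres `X_t`, `t ∈ W`, whose homology classes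
`[δ t] ∈ H_n(X_t, ℤ)` are obtained from each other by parallel transport, i.e. form a section over
`W` of the local system of the homology groups of the fibres. -/
def IsParallelFamily {n : ℕ} (f : Space n → ℂ) (ε r : ℝ) (W : Set ℂ)
    (δ : ℂ → Chain n n) : Prop :=
  (∀ t ∈ W, (δ t).IsSmoothIn (fibre f ε r t) ∧ (δ t).IsCycle) ∧
  ∀ t₀ ∈ W, ∃ (ρ : ℝ) (Φ : Space n → ℂ → Space n) (Ψ : Space n → Space n),
    IsLocalTrivialization f ε r t₀ ρ Φ Ψ ∧
    ∀ s ∈ Metric.ball t₀ ρ ∩ W,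
      Chain.Homologous (fibre f ε r s) ((δ t₀).map fun x => Φ x s) (δ s)

/-- The tube of radius `a` over a cube in `X_t`: each point `x` is replaced by the circle
`θ ↦ Φ x (t + a e^{2πiθ})`, which encircles `X_t` once in the positive direction. The circle
coordinate is the last one. -/
def Cube.tube {n k : ℕ} (Φ : Space n → ℂ → Space n) (t : ℂ) (a : ℝ) (σ : Cube n k) :
    Cube n (k + 1) :=
  fun y => Φ (σ (Fin.init y))
    (t + a * Complex.exp (2 * Real.pi * Complex.I * ((y (Fin.last k) : ℝ) : ℂ)))

/-- The tube of radius `a` over a chain in `X_t`. -/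
def Chain.tube {n k : ℕ} (Φ : Space n → ℂ → Space n) (t : ℂ) (a : ℝ) (c : Chain n k) :
    Chain n (k + 1) :=
  Finsupp.mapDomain (Cube.tube Φ t a) c

/-- `Δ` is a smooth cycle in `X \ X_t` representing the homology class of the tube over the
`n`-cycle `δ` in `X_t`. -/
def IsTubeCycle {n : ℕ} (f : Space n → ℂ) (ε r : ℝ) (t : ℂ)
    (δ : Chain n n) (Δ : Chain n (n + 1)) : Prop :=
  Δ.IsSmoothIn (total f ε r \ fibre f ε r t) ∧ Δ.IsCycle ∧
  ∃ (ρ : ℝ) (Φ : Space n → ℂ → Space n) (Ψ : Space n → Space n) (a : ℝ),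
    IsLocalTrivialization f ε r t ρ Φ Ψ ∧ 0 < a ∧ a < ρ ∧
    Chain.Homologous (total f ε r \ fibre f ε r t) (δ.tube Φ t a) Δ

/-! ### The operation `b` and the period integrals -/

/-- The form `df ∧ η`:
`(df ∧ η)(v₀, …, v_p) = ∑ᵢ (-1)ⁱ df(vᵢ) η(v₀, …, v̂ᵢ, …, v_p)`. -/
def dWedge {n p : ℕ} (f : Space n → ℂ) (η : DiffForm n p) : DiffForm n (p + 1) :=
  fun x => ContinuousAlternatingMap.alternatizeUncurryFin ((fderiv ℂ f x).smulRight (η x))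

/-- `ω` and `bω` are holomorphic `(n+1)`-forms on `X` with `ω = dη` and `bω = df ∧ η` on `X` for a
holomorphic `n`-form `η` on `X` (holomorphic on `X` means: on a neighbourhood of `X`). -/
def IsBOf {n : ℕ} (f : Space n → ℂ) (X : Set (Space n)) (ω bω : DiffForm n (n + 1)) : Prop :=
  ∃ η : DiffForm n n, AnalyticOnNhd ℂ η X ∧
    ∀ x ∈ X, ω x = extDeriv η x ∧ bω x = dWedge f η x

/-- The period integral `∫_Δ ω / (f - t)`. -/
def period {n : ℕ} (f : Space n → ℂ) (Δ : Chain n (n + 1)) (ω : DiffForm n (n + 1)) (t : ℂ) : ℂ :=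
  Δ.integral fun x => (f x - t)⁻¹ • ω x

end MilnorPeriod

end

noncomputable section

namespace MilnorPeriod

open Set MeasureTheory Filter Topology

/-! ### Cubes on the closed unit box -/

/-! Near a fixed `t`, a trivialization `Φ` transports an `n`-cycle `c` of `X_t` to cycles `c_s` in
`X_s`. For an `(n+1)`-form `ω` let `L_ω(s)` be the integral over `c_s` of `ω` contracted with the
lift of `∂/∂s` (`Chain.leray`), the Gelfand–Leray residue of `ω`. On vertical vectors this does not
depend on the lift, because `n + 1` vectors in `ker df` are linearly dependent. Fubini then turns
the integral of `h(f) ω` over the prism swept out along a path `γ` into `∫ h(γ) L_ω(γ) γ' dτ`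
(`integral_chain_prism`).

Three consequences carry the proof. Put `I(s) = ∫_{c_s} η`. (1) Pointwise, contracting `df ∧ η`
gives `η` on the fibre up to sign, so `L_{df∧η} = (-1)^n I` (`leray_dWedge`). (2) Stokes on the
prism over the segment from `s` to `s'` gives `I(s') - I(s) = (-1)^n ∫ L_{dη} ds`; since `L_{dη}` is
continuous, `I` is complex differentiable with `I' = (-1)^n L_{dη}` (`hasDerivAt_integral_map`). (3)
Hence `L_{df∧η}` and `L_{dη}` are both holomorphic, and over the tube the mean value property yields
`∫ ω/(f - t) = 2πi L_ω(t)` for `ω = df ∧ η` and `ω = dη` (`integral_tube`).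

So the period of `bω` is `2πi (-1)^n I`, and its derivative `2πi L_{dη}(t)` is the period of `dη`.
Replacing cycles by homologous ones is harmless: `(n+1)`-forms are closed on `X \ X_t` for reasons
of degree, and `dη` vanishes on each fibre. -/

open scoped ContDiff in
theorem two_le_infty : (2 : WithTop ℕ∞) ≤ ∞ :=
  WithTop.coe_le_coe.2 (le_top : (2 : ℕ∞) ≤ ⊤)

theorem uniqueDiffOn_unitBox (k : ℕ) : UniqueDiffOn ℝ (Icc (0 : Fin k → ℝ) 1) := by
  rw [← pi_univ_Icc]
  exact UniqueDiffOn.univ_pi fun i => uniqueDiffOn_Icc (by simp)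

theorem subset_closure_interior_unitBox (k : ℕ) :
    Icc (0 : Fin k → ℝ) 1 ⊆ closure (interior (Icc (0 : Fin k → ℝ) 1)) := by
  intro x hx
  rw [← pi_univ_Icc, interior_pi_set finite_univ, closure_pi_set]
  intro i _
  simp only [interior_Icc, Pi.zero_apply, Pi.one_apply]
  rw [closure_Ioo (by norm_num)]
  exact ⟨hx.1 i, hx.2 i⟩

theorem insertNth_mem_unitBox {k : ℕ} (i : Fin (k + 1)) (e : unitInterval) {x : Fin k → ℝ}
    (hx : x ∈ Icc (0 : Fin k → ℝ) 1) :
    i.insertNth (e : ℝ) x ∈ Icc (0 : Fin (k + 1) → ℝ) 1 := by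
  constructor
  · intro j
    refine Fin.succAboveCases i ?_ (fun l => ?_) j
    · simpa using e.2.1
    · simpa using hx.1 l
  · intro j
    refine Fin.succAboveCases i ?_ (fun l => ?_) j
    · simpa using e.2.2
    · simpa using hx.2 l

open scoped ContDiff in
theorem Cube.IsSmooth.contDiffOn {n k : ℕ} {σ : Cube n k} (hσ : σ.IsSmooth) :
    ContDiffOn ℝ ∞ σ.extend (Icc 0 1) := hσ

theorem Cube.IsSmooth.differentiableOn {n k : ℕ} {σ : Cube n k} (hσ : σ.IsSmooth) :
    DifferentiableOn ℝ σ.extend (Icc 0 1) := hσ.contDiffOn.differentiableOn (by simp)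

theorem Cube.extend_face {n k : ℕ} (σ : Cube n (k + 1)) (i : Fin (k + 1)) (e : unitInterval)
    (x : Fin k → ℝ) : (σ.face i e).extend x = σ.extend (i.insertNth (e : ℝ) x) := by
  unfold Cube.extend Cube.face
  congr 1
  funext j
  refine Fin.succAboveCases i ?_ (fun l => ?_) j
  · simp
  · simp

theorem Cube.extend_mem {n k : ℕ} {σ : Cube n k} {Y : Set (Space n)} (h : ∀ y, σ y ∈ Y)
    (x : Fin k → ℝ) : σ.extend x ∈ Y := h _

/-- The affine embedding of a face has the evident derivative. -/
theorem hasFDerivAt_insertNth {k : ℕ} (i : Fin (k + 1)) (e : ℝ) (x : Fin k → ℝ) :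
    HasFDerivAt (fun x : Fin k → ℝ => (i.insertNth e x : Fin (k + 1) → ℝ))
      (ContinuousLinearMap.pi fun j : Fin (k + 1) =>
        (i.insertNth (0 : (Fin k → ℝ) →L[ℝ] ℝ)
          (fun l => ContinuousLinearMap.proj (R := ℝ) (φ := fun _ : Fin k => ℝ) l) :
            Fin (k + 1) → ((Fin k → ℝ) →L[ℝ] ℝ)) j) x := by
  rw [hasFDerivAt_pi]
  intro j
  refine Fin.succAboveCases i ?_ (fun l => ?_) j
  · simpa using hasFDerivAt_const (𝕜 := ℝ) e x
  · simpa using hasFDerivAt_apply (𝕜 := ℝ) l x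

theorem Cube.fderivWithin_extend_face {n k : ℕ} {σ : Cube n (k + 1)} (hσ : σ.IsSmooth)
    (i : Fin (k + 1)) (e : unitInterval) {x : Fin k → ℝ} (hx : x ∈ Icc (0 : Fin k → ℝ) 1)
    (j : Fin k) :
    fderivWithin ℝ (σ.face i e).extend (Icc 0 1) x (Pi.single j 1) =
      fderivWithin ℝ σ.extend (Icc 0 1) (i.insertNth (e : ℝ) x) (Pi.single (i.succAbove j) 1) := by
  have h1 : (σ.face i e).extend = fun x => σ.extend (i.insertNth (e : ℝ) x) :=
    funext (σ.extend_face i e)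
  have hd : DifferentiableWithinAt ℝ σ.extend (Icc 0 1) (i.insertNth (e : ℝ) x) :=
    hσ.differentiableOn _ (insertNth_mem_unitBox i e hx)
  have h2 := hd.hasFDerivWithinAt.comp x (hasFDerivAt_insertNth i (e : ℝ) x).hasFDerivWithinAt
    (fun y hy => insertNth_mem_unitBox i e hy)
  have h3 : fderivWithin ℝ (fun x : Fin k → ℝ => σ.extend (i.insertNth (e : ℝ) x)) (Icc 0 1) x =
      _ :=
    h2.fderivWithin (uniqueDiffOn_unitBox k x hx)
  rw [h1, h3, ContinuousLinearMap.comp_apply]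
  congr 1
  funext l
  refine Fin.succAboveCases i ?_ (fun l => ?_) l
  · simp
  · simp [Pi.single_apply]

/-! ### Pullbacks of holomorphic forms -/

/-- The pullback of a form along a cube, as a real differential form on the box. -/
def Cube.pullback {n k p : ℕ} (σ : Cube n k) (α : DiffForm n p) (y : Fin k → ℝ) :
    (Fin k → ℝ) [⋀^Fin p]→L[ℝ] ℂ :=
  ((α (σ.extend y)).restrictScalars ℝ).compContinuousLinearMap
    (fderivWithin ℝ σ.extend (Icc 0 1) y)

theorem Cube.pullback_apply {n k p : ℕ} (σ : Cube n k) (α : DiffForm n p) (y : Fin k → ℝ)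
    (v : Fin p → Fin k → ℝ) :
    σ.pullback α y v = α (σ.extend y) fun i => fderivWithin ℝ σ.extend (Icc 0 1) y (v i) := rfl

theorem Cube.integral_eq_pullback {n k : ℕ} (σ : Cube n k) (α : DiffForm n k) :
    σ.integral α = ∫ y in Icc (0 : Fin k → ℝ) 1, σ.pullback α y fun i => Pi.single i 1 := rfl

theorem hasFDerivAt_restrictScalars_form {n p : ℕ} {α : DiffForm n p} {x : Space n}
    (h : DifferentiableAt ℂ α x) :
    HasFDerivAt (fun x => (α x).restrictScalars ℝ)
      (((ContinuousAlternatingMap.restrictScalarsLI (𝕜 := ℂ) (E := Space n) (F := ℂ)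
        (ι := Fin p) ℝ).toContinuousLinearMap).comp ((fderiv ℂ α x).restrictScalars ℝ)) x :=
  (ContinuousAlternatingMap.restrictScalarsLI (𝕜 := ℂ) (E := Space n) (F := ℂ)
        (ι := Fin p) ℝ).toContinuousLinearMap.hasFDerivAt.comp x
    (h.hasFDerivAt.restrictScalars ℝ)

/-- Both sides alternatize the same differential. Forms are complex while cubes have real
parameters, so this links the two calculi. -/
theorem extDeriv_restrictScalars {n p : ℕ} {α : DiffForm n p} {x : Space n}
    (h : DifferentiableAt ℂ α x) :
    extDeriv (fun x => (α x).restrictScalars ℝ) x = (extDeriv α x).restrictScalars ℝ := by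
  ext v
  rw [extDeriv, (hasFDerivAt_restrictScalars_form h).fderiv]
  rw [ContinuousAlternatingMap.coe_restrictScalars, extDeriv,
    ContinuousAlternatingMap.alternatizeUncurryFin_apply,
    ContinuousAlternatingMap.alternatizeUncurryFin_apply]
  rfl

theorem Cube.differentiableOn_pullback {n k p : ℕ} {σ : Cube n k} (hσ : σ.IsSmooth)
    {Y : Set (Space n)} (hY : ∀ y, σ y ∈ Y) {α : DiffForm n p} (hα : AnalyticOnNhd ℂ α Y) :
    DifferentiableOn ℝ (σ.pullback α) (Icc 0 1) := by
  intro y hy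
  have h1 : DifferentiableWithinAt ℝ σ.extend (Icc 0 1) y := hσ.differentiableOn y hy
  have h2 : DifferentiableWithinAt ℝ (fun y => fderivWithin ℝ σ.extend (Icc 0 1) y) (Icc 0 1) y :=
    ((hσ.contDiffOn.fderivWithin (uniqueDiffOn_unitBox k) (m := 1)
      two_le_infty).differentiableOn (by simp)) y hy
  have h3 := (hasFDerivAt_restrictScalars_form (hα _ (σ.extend_mem hY y)).differentiableAt)
    |>.differentiableAt.comp_differentiableWithinAt y h1
  exact DifferentiableWithinAt.continuousAlternatingMapCompContinuousLinearMap h3 h2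

theorem Cube.continuousOn_pullback_apply {n k p : ℕ} {σ : Cube n k} (hσ : σ.IsSmooth)
    {Y : Set (Space n)} (hY : ∀ y, σ y ∈ Y) {α : DiffForm n p} (hα : AnalyticOnNhd ℂ α Y)
    (v : Fin p → Fin k → ℝ) :
    ContinuousOn (fun y => σ.pullback α y v) (Icc 0 1) := by
  have := (Cube.differentiableOn_pullback hσ hY hα).continuousOn
  exact (ContinuousAlternatingMap.apply ℝ (Fin k → ℝ) ℂ v).continuous.comp_continuousOn this

theorem analyticOnNhd_extDeriv {n p : ℕ} {Y : Set (Space n)} {α : DiffForm n p}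
    (hα : AnalyticOnNhd ℂ α Y) : AnalyticOnNhd ℂ (extDeriv α) Y := fun x hx =>
  (ContinuousAlternatingMap.alternatizeUncurryFinCLM (n := p) ℂ (Space n) ℂ).analyticAt
    (fderiv ℂ α x) |>.fun_comp (hα x hx).fderiv

-- Naturality of `d` rests on the symmetry of the second derivative of the cube. On the boundary of
-- the box this symmetry comes from the interior, which is dense in the box.
open scoped ContDiff in
theorem Cube.extDerivWithin_pullback {n k p : ℕ} {σ : Cube n k} (hσ : σ.IsSmooth)
    {Y : Set (Space n)} (hY : ∀ y, σ y ∈ Y) {α : DiffForm n p} (hα : AnalyticOnNhd ℂ α Y)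
    {y : Fin k → ℝ} (hy : y ∈ Icc (0 : Fin k → ℝ) 1) :
    extDerivWithin (σ.pullback α) (Icc 0 1) y = σ.pullback (extDeriv α) y := by
  have hd := (hα _ (σ.extend_mem hY y)).differentiableAt
  have := _root_.extDerivWithin_pullback (𝕜 := ℝ) (r := ∞) (t := univ) (f := σ.extend)
    (hasFDerivAt_restrictScalars_form hd).differentiableAt.differentiableWithinAt
    (hσ.contDiffOn y hy) (by rw [minSmoothness_of_isRCLikeNormedField]; exact two_le_infty)
    (uniqueDiffOn_unitBox k)
    (subset_closure_interior_unitBox k hy) hy (mapsTo_univ _ _)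
  rw [extDerivWithin_univ, extDeriv_restrictScalars hd] at this
  exact this

/-- Stokes' theorem for a smooth cube. -/
theorem Cube.integral_extDeriv {n k : ℕ} {σ : Cube n (k + 1)} (hσ : σ.IsSmooth)
    {Y : Set (Space n)} (hY : ∀ y, σ y ∈ Y) {α : DiffForm n k} (hα : AnalyticOnNhd ℂ α Y) :
    σ.integral (extDeriv α) = ∑ i : Fin (k + 1),
      (-1) ^ (i : ℕ) * ((σ.face i 1).integral α - (σ.face i 0).integral α) := by
  set e : Fin (k + 1) → Fin (k + 1) → ℝ := fun i => Pi.single i 1 with he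
  set P := σ.pullback α with hP
  have hPd := Cube.differentiableOn_pullback hσ hY hα
  -- The vector field dual to `σ^*α`: its `i`-th component is the signed coefficient omitting
  -- `dy_i`, so that its divergence is the coefficient of `d(σ^*α)`.
  set f : Fin (k + 1) → (Fin (k + 1) → ℝ) → ℂ :=
    fun i y => (-1) ^ (i : ℕ) * P y (i.removeNth e) with hf
  have hfd : ∀ i, DifferentiableOn ℝ (f i) (Icc 0 1) := fun i =>
    ((ContinuousAlternatingMap.apply ℝ (Fin (k + 1) → ℝ) ℂ
      (i.removeNth e)).differentiable.comp_differentiableOn hPd).const_mul _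
  have hsum : ∀ y ∈ Icc (0 : Fin (k + 1) → ℝ) 1,
      ∑ i, fderivWithin ℝ (f i) (Icc 0 1) y (e i) = σ.pullback (extDeriv α) y e := by
    intro y hy
    rw [← Cube.extDerivWithin_pullback hσ hY hα hy,
      extDerivWithin_apply (hPd y hy) (uniqueDiffOn_unitBox _ y hy)]
    refine Finset.sum_congr rfl fun i _ => ?_
    have hd : DifferentiableWithinAt ℝ (fun y => P y (i.removeNth e)) (Icc 0 1) y :=
      (ContinuousAlternatingMap.apply ℝ (Fin (k + 1) → ℝ) ℂ
        (i.removeNth e)).differentiableAt.comp_differentiableWithinAt y (hPd y hy)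
    rw [hf]
    simp only
    rw [fderivWithin_const_mul (uniqueDiffOn_unitBox _ y hy) hd]
    simp [hP]
  have hdiv := integral_divergence_of_hasFDerivAt_off_countable' (0 : Fin (k + 1) → ℝ) 1
    (by intro i; simp) f (fun i y => fderivWithin ℝ (f i) (Icc 0 1) y) ∅ countable_empty
    (fun i => (hfd i).continuousOn)
    (fun y hy i => by
      have hy' : Icc (0 : Fin (k + 1) → ℝ) 1 ∈ 𝓝 y := by
        rw [← pi_univ_Icc]
        exact set_pi_mem_nhds finite_univ fun j _ =>
          Icc_mem_nhds (hy.1 j (mem_univ j)).1 (hy.1 j (mem_univ j)).2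
      exact ((hfd i) y (mem_of_mem_nhds hy')).hasFDerivWithinAt.hasFDerivAt hy')
    ((((Cube.continuousOn_pullback_apply hσ hY (analyticOnNhd_extDeriv hα) e).integrableOn_compact
      isCompact_Icc)).congr_fun (fun y hy => (hsum y hy).symm) measurableSet_Icc)
  rw [Cube.integral_eq_pullback, ← setIntegral_congr_fun measurableSet_Icc hsum, hdiv]
  refine Finset.sum_congr rfl fun i _ => ?_
  have hface : ∀ u : unitInterval,
      ∫ x in Icc (0 : Fin k → ℝ) 1, f i (i.insertNth (u : ℝ) x) =
        (-1) ^ (i : ℕ) * (σ.face i u).integral α := by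
    intro u
    rw [Cube.integral, ← integral_const_mul]
    refine setIntegral_congr_fun measurableSet_Icc fun x hx => ?_
    simp only [hf, hP, Cube.pullback_apply, Cube.extend_face]
    congr 2
    funext j
    rw [Cube.fderivWithin_extend_face hσ i u hx j]
    rfl
  have h1 := hface 1
  have h0 := hface 0
  simp only [Icc.coe_zero, Icc.coe_one] at h0 h1
  rw [mul_sub, ← h1, ← h0]
  rfl

/-! ### Integration over chains -/

/-- Integration of a fixed form, as a homomorphism on chains. -/
def Chain.integralHom {n k : ℕ} (α : DiffForm n k) : Chain n k →+ ℂ :=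
  Finsupp.liftAddHom fun σ => (AddMonoidHom.mulRight (σ.integral α)).comp (Int.castAddHom ℂ)

theorem Chain.integralHom_apply {n k : ℕ} (α : DiffForm n k) (c : Chain n k) :
    Chain.integralHom α c = c.integral α := rfl

theorem Chain.integral_single {n k : ℕ} (σ : Cube n k) (a : ℤ) (α : DiffForm n k) :
    Chain.integral (Finsupp.single σ a) α = a * σ.integral α := by
  simp [Chain.integral]

theorem Chain.integral_congr {n k : ℕ} {c : Chain n k} {α β : DiffForm n k}
    (h : ∀ σ ∈ c.support, σ.integral α = σ.integral β) : c.integral α = c.integral β :=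
  Finset.sum_congr rfl fun σ hσ => by simp only [h σ hσ]

theorem Chain.integral_mapDomain {n k l : ℕ} (g : Cube n k → Cube n l) (c : Chain n k)
    (α : DiffForm n l) :
    Chain.integral (Finsupp.mapDomain g c) α = c.sum fun σ a => (a : ℂ) * (g σ).integral α := by
  unfold Chain.integral
  exact Finsupp.sum_mapDomain_index (by simp) (by intros; push_cast; ring)

/-- The derivative in the direction of the idle coordinate is zero, so the form is evaluated on a
tuple containing a zero vector. -/
theorem Cube.IsDegenerate.integral_eq_zero {n k : ℕ} {σ : Cube n k} (hσ : σ.IsDegenerate)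
    (α : DiffForm n k) : σ.integral α = 0 := by
  obtain ⟨i, hi⟩ := hσ
  have hconst : ∀ (y : Fin k → ℝ) (s : ℝ), σ.extend (Function.update y i s) = σ.extend y := by
    intro y s
    unfold Cube.extend
    rw [← hi (fun j => projIcc 0 1 zero_le_one (y j)) (projIcc 0 1 zero_le_one s)]
    congr 1
    funext j
    rcases eq_or_ne j i with rfl | hj
    · simp
    · simp [hj]
  refine setIntegral_eq_zero_of_forall_eq_zero fun y hy => ?_
  refine ContinuousAlternatingMap.map_coord_zero _ i ?_
  by_cases hd : DifferentiableWithinAt ℝ σ.extend (Icc 0 1) y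
  · have hc : HasDerivWithinAt (fun s => Function.update y i s) (Pi.single i (1 : ℝ))
        (Icc (0 : ℝ) 1) (y i) := (hasDerivAt_update y i (y i)).hasDerivWithinAt
    have hm : MapsTo (fun s => Function.update y i s) (Icc (0 : ℝ) 1) (Icc 0 1) := by
      intro s hs
      refine ⟨fun j => ?_, fun j => ?_⟩
      · rcases eq_or_ne j i with rfl | hj
        · simpa using hs.1
        · simpa [hj] using hy.1 j
      · rcases eq_or_ne j i with rfl | hj
        · simpa using hs.2
        · simpa [hj] using hy.2 j
    have hd' : HasFDerivWithinAt σ.extend (fderivWithin ℝ σ.extend (Icc 0 1) y) (Icc 0 1)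
        (Function.update y i (y i)) := by
      rw [Function.update_eq_self]; exact hd.hasFDerivWithinAt
    have h1 := hd'.comp_hasDerivWithinAt (y i) hc hm
    have h2 : HasDerivWithinAt (σ.extend ∘ fun s => Function.update y i s) 0
        (Icc (0 : ℝ) 1) (y i) := by
      have : (σ.extend ∘ fun s => Function.update y i s) = fun _ => σ.extend y :=
        funext fun s => hconst y s
      rw [this]; exact hasDerivWithinAt_const _ _ _
    exact (uniqueDiffOn_Icc zero_lt_one (y i) ⟨hy.1 i, hy.2 i⟩).eq_deriv _ h1 h2
  -- Degenerate cubes need not be smooth; where the derivative does not exist, `fderivWithin` is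
  -- zero by convention.
  · rw [fderivWithin_zero_of_not_differentiableWithinAt hd]; rfl

theorem Chain.IsDegenerate.integral_eq_zero {n k : ℕ} {c : Chain n k} (hc : c.IsDegenerate)
    (α : DiffForm n k) : c.integral α = 0 :=
  Finset.sum_eq_zero fun σ hσ => by simp only [(hc σ hσ).integral_eq_zero, mul_zero]

theorem Chain.integral_boundary {n k : ℕ} (c : Chain n (k + 1)) (α : DiffForm n k) :
    c.boundary.integral α = c.sum fun σ a => (a : ℂ) * ∑ i : Fin (k + 1),
      (-1) ^ (i : ℕ) * ((σ.face i 1).integral α - (σ.face i 0).integral α) := by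
  rw [← Chain.integralHom_apply, Chain.boundary, Finsupp.sum, map_sum]
  refine Finset.sum_congr rfl fun σ _ => ?_
  rw [map_zsmul, map_sum, zsmul_eq_mul]
  congr 1
  refine Finset.sum_congr rfl fun i _ => ?_
  rw [map_zsmul, map_sub, Chain.integralHom_apply, Chain.integralHom_apply,
    Chain.integral_single, Chain.integral_single, zsmul_eq_mul]
  push_cast
  ring

/-- Stokes' theorem for smooth chains. -/
theorem Chain.IsSmoothIn.integral_boundary {n k : ℕ} {c : Chain n (k + 1)} {Y : Set (Space n)}
    (hc : c.IsSmoothIn Y) {α : DiffForm n k} (hα : AnalyticOnNhd ℂ α Y) :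
    c.boundary.integral α = c.integral (extDeriv α) := by
  rw [Chain.integral_boundary]
  exact Finset.sum_congr rfl fun σ hσ => by
    simp only [Cube.integral_extDeriv (hc σ hσ).1 (hc σ hσ).2 hα]

/-- Closedness is required only after pullback to smooth cubes in `Y`. This covers both uses:
top-degree forms, which are closed, and `η` on a fibre, where `dη` need not vanish as a form but has
zero integral over cubes. -/
theorem Chain.Homologous.integral_eq {n k : ℕ} {Y : Set (Space n)} {c c' : Chain n k}
    (h : Chain.Homologous Y c c') {α : DiffForm n k} (hα : AnalyticOnNhd ℂ α Y)
    (hclosed : ∀ σ : Cube n (k + 1), σ.IsSmooth → (∀ y, σ y ∈ Y) → σ.integral (extDeriv α) = 0) :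
    c'.integral α = c.integral α := by
  obtain ⟨e, he, hdeg⟩ := h
  have h1 := hdeg.integral_eq_zero α
  rw [← Chain.integralHom_apply, map_sub, map_sub, Chain.integralHom_apply,
    Chain.integralHom_apply, Chain.integralHom_apply, he.integral_boundary hα] at h1
  have h2 : e.integral (extDeriv α) = 0 := Finset.sum_eq_zero fun σ hσ => by
    simp only [hclosed σ (he σ hσ).1 (he σ hσ).2, mul_zero]
  rw [h2, sub_zero] at h1
  exact sub_eq_zero.1 h1

theorem Cube.integral_congr {n k : ℕ} {σ : Cube n k} {Y : Set (Space n)} (hY : ∀ y, σ y ∈ Y)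
    {α β : DiffForm n k} (h : ∀ x ∈ Y, α x = β x) : σ.integral α = σ.integral β :=
  setIntegral_congr_fun measurableSet_Icc fun y _ => by
    simp only [h _ (σ.extend_mem hY y)]

/-! ### Forms of top degree -/

theorem extDeriv_eq_zero_of_top {n : ℕ} (α : DiffForm n (n + 1)) (x : Space n) :
    extDeriv α x = 0 := by
  ext v
  refine AlternatingMap.map_linearDependent (extDeriv α x).toAlternatingMap v fun hv => ?_
  have := hv.fintype_card_le_finrank
  simp at this

/-- If the `n + 1` vectors were independent they would form a basis on which `L` vanishes. -/
theorem topForm_eq_zero_of_ker {n : ℕ} {L : Space n →L[ℂ] ℂ} (hL : L ≠ 0)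
    (β : (Space n) [⋀^Fin (n + 1)]→L[ℂ] ℂ) {v : Fin (n + 1) → Space n} (hv : ∀ i, L (v i) = 0) :
    β v = 0 := by
  refine AlternatingMap.map_linearDependent β.toAlternatingMap v fun hli => hL ?_
  have hspan := hli.span_eq_top_of_card_eq_finrank' (by simp)
  have : (L : Space n →ₗ[ℂ] ℂ) = 0 := by
    refine LinearMap.ext_on_range hspan fun i => by simpa using hv i
  exact ContinuousLinearMap.coe_injective this

/-- With the other arguments in `ker L`, the functional `β(w, ·)` kills `ker L` and is therefore a
multiple of `L`. This is the pointwise division of `β` by `L = df` behind the Gelfand–Leray residue.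
-/
theorem topForm_snoc_eq_mul {n : ℕ} {L : Space n →L[ℂ] ℂ} (β : (Space n) [⋀^Fin (n + 1)]→L[ℂ] ℂ)
    {w : Fin n → Space n} (hw : ∀ i, L (w i) = 0) {v u : Space n} (hu : L u = 1) {c : ℂ}
    (hv : L v = c) :
    β (Fin.snoc w v : Fin (n + 1) → Space n) = c * β (Fin.snoc w u : Fin (n + 1) → Space n) := by
  have hL : L ≠ 0 := by rintro rfl; simp at hu
  have h0 : β (Fin.snoc w (v - c • u) : Fin (n + 1) → Space n) = 0 := by
    refine topForm_eq_zero_of_ker hL β fun i => ?_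
    refine Fin.lastCases ?_ (fun j => ?_) i
    · simp [hu, hv]
    · simpa using hw j
  have key : ∀ z : Space n, (Fin.snoc w z : Fin (n + 1) → Space n) =
      Function.update (Fin.snoc w 0 : Fin (n + 1) → Space n) (Fin.last n) z := fun z => by
    rw [Fin.update_snoc_last]
  rw [key, ContinuousAlternatingMap.map_update_sub, ContinuousAlternatingMap.map_update_smul,
    ← key, ← key, sub_eq_zero] at h0
  simpa using h0

/-- Only the term in which `df` takes the last argument survives, and its sign is `(-1)^n`. -/
theorem dWedge_snoc {n : ℕ} (f : Space n → ℂ) (η : DiffForm n n) (x : Space n)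
    {w : Fin n → Space n} (hw : ∀ i, fderiv ℂ f x (w i) = 0) (v : Space n) :
    dWedge f η x (Fin.snoc w v : Fin (n + 1) → Space n) =
      (-1) ^ n * (fderiv ℂ f x v * η x w) := by
  rw [dWedge, ContinuousAlternatingMap.alternatizeUncurryFin_apply, Fin.sum_univ_castSucc]
  have h0 : ∀ i : Fin n, fderiv ℂ f x ((Fin.snoc w v : Fin (n + 1) → Space n) i.castSucc) = 0 :=
    fun i => by simpa using hw i
  have h1 : (Fin.last n).removeNth (Fin.snoc w v : Fin (n + 1) → Space n) = w := by
    rw [Fin.removeNth_last, Fin.init_snoc]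
  simp [hw, h1]

theorem _root_.AnalyticAt.smulRight {E F G : Type*} [NormedAddCommGroup E] [NormedSpace ℂ E]
    [NormedAddCommGroup F] [NormedSpace ℂ F] [NormedAddCommGroup G] [NormedSpace ℂ G]
    {g : E → F →L[ℂ] ℂ} {h : E → G} {x : E} (hg : AnalyticAt ℂ g x) (hh : AnalyticAt ℂ h x) :
    AnalyticAt ℂ (fun x => (g x).smulRight (h x)) x :=
  AnalyticAt.fun_comp (f := fun x => (g x, h x))
    ((ContinuousLinearMap.smulRightL ℂ F G).analyticAt_bilinear (g x, h x)) (hg.prod hh)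

theorem analyticOnNhd_dWedge {n p : ℕ} {Y : Set (Space n)} {f : Space n → ℂ} {η : DiffForm n p}
    (hf : AnalyticOnNhd ℂ f Y) (hη : AnalyticOnNhd ℂ η Y) :
    AnalyticOnNhd ℂ (dWedge f η) Y := fun x hx => by
  have h1 : AnalyticAt ℂ (fun x => (fderiv ℂ f x).smulRight (η x)) x :=
    (hf x hx).fderiv.smulRight (hη x hx)
  exact (ContinuousAlternatingMap.alternatizeUncurryFinCLM (n := p) ℂ (Space n) ℂ).analyticAt _
    |>.fun_comp h1

/-! ### The fibration -/

theorem IsGoodRepresentative.analytic_total {n : ℕ} {f : Space n → ℂ} {ε r : ℝ}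
    (hf : IsGoodRepresentative f ε r) : AnalyticOnNhd ℂ f (total f ε r) :=
  hf.analytic.mono fun x hx => by simpa using hx.1

theorem IsGoodRepresentative.fderiv_ne_zero {n : ℕ} {f : Space n → ℂ} {ε r : ℝ}
    (hf : IsGoodRepresentative f ε r) {x : Space n} (hx : x ∈ total f ε r) (h0 : f x ≠ 0) :
    fderiv ℂ f x ≠ 0 := fun h => h0 <| by
  rw [(hf.critical x (by simpa using hx.1)).1 h, hf.map_zero]

/-- A closed cube in a fibre has tangent vectors in the kernel of `df`. -/
theorem fderiv_apply_eq_zero_of_mem_fibre {n k : ℕ} {f : Space n → ℂ} {ε r : ℝ}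
    (hf : IsGoodRepresentative f ε r) {t : ℂ} {g : (Fin k → ℝ) → Space n}
    {g' : (Fin k → ℝ) →L[ℝ] Space n} {y : Fin k → ℝ} (hy : y ∈ Icc (0 : Fin k → ℝ) 1)
    (hg : HasFDerivWithinAt g g' (Icc 0 1) y)
    (hmem : ∀ y ∈ Icc (0 : Fin k → ℝ) 1, g y ∈ fibre f ε r t) (v : Fin k → ℝ) :
    fderiv ℂ f (g y) (g' v) = 0 := by
  have h1 := ((hf.analytic_total _ (hmem y hy).1).differentiableAt.hasFDerivAt.restrictScalars
    ℝ).comp_hasFDerivWithinAt y hg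
  have h2 : HasFDerivWithinAt (f ∘ g) (0 : (Fin k → ℝ) →L[ℝ] ℂ) (Icc 0 1) y :=
    (hasFDerivWithinAt_const t y _).congr (fun z hz => (hmem z hz).2) (hmem y hy).2
  have h3 := (uniqueDiffOn_unitBox k y hy).eq h1 h2
  exact DFunLike.congr_fun h3 v

/-- Tangent vectors of the cube lie in `ker df`, a proper subspace since `f` has no critical point
on `X_t`, `t ≠ 0`. Hence integrals of holomorphic `n`-forms over cycles in `X_t` depend only on
homology classes. -/
theorem Cube.integral_extDeriv_eq_zero_of_mem_fibre {n : ℕ} {f : Space n → ℂ} {ε r : ℝ}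
    (hf : IsGoodRepresentative f ε r) {t : ℂ} (ht : t ≠ 0) {σ : Cube n (n + 1)}
    (hσ : σ.IsSmooth) (hmem : ∀ y, σ y ∈ fibre f ε r t) (β : DiffForm n (n + 1)) :
    σ.integral β = 0 := by
  refine setIntegral_eq_zero_of_forall_eq_zero fun y hy => ?_
  have hx := σ.extend_mem hmem y
  exact topForm_eq_zero_of_ker (hf.fderiv_ne_zero hx.1 (by rw [hx.2]; exact ht)) _ fun i =>
    fderiv_apply_eq_zero_of_mem_fibre hf hy (hσ.differentiableOn y hy).hasFDerivWithinAt
      (fun z _ => σ.extend_mem hmem z) _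

/-! ### Local trivializations -/

/-- The total real derivative of a family of maps `Φ` at `(x, s)`. -/
def familyFDeriv {n : ℕ} (Φ : Space n → ℂ → Space n) (p : Space n × ℂ) :
    Space n × ℂ →L[ℝ] Space n :=
  fderiv ℝ (fun p : Space n × ℂ => Φ p.1 p.2) p

namespace IsLocalTrivialization

variable {n : ℕ} {f : Space n → ℂ} {ε r : ℝ} {t₀ : ℂ} {ρ : ℝ} {Φ : Space n → ℂ → Space n}
  {Ψ : Space n → Space n}

theorem ne_zero (hT : IsLocalTrivialization f ε r t₀ ρ Φ Ψ) {s : ℂ}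
    (hs : s ∈ Metric.ball t₀ ρ) : s ≠ 0 := (hT.ball_subset hs).1

theorem hasFDerivAt (hT : IsLocalTrivialization f ε r t₀ ρ Φ Ψ) {x : Space n}
    (hx : x ∈ fibre f ε r t₀) {s : ℂ} (hs : s ∈ Metric.ball t₀ ρ) :
    HasFDerivAt (fun p : Space n × ℂ => Φ p.1 p.2) (familyFDeriv Φ (x, s)) (x, s) := by
  obtain ⟨V, hV, hsub, hΦ⟩ := hT.smooth
  have hp : (x, s) ∈ V := hsub ⟨hx, hs⟩
  have hd : DifferentiableAt ℝ (fun p : Space n × ℂ => Φ p.1 p.2) (x, s) :=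
    (hΦ.contDiffAt (hV.mem_nhds hp)).differentiableAt (by simp)
  exact hd.hasFDerivAt

theorem continuousOn_familyFDeriv (hT : IsLocalTrivialization f ε r t₀ ρ Φ Ψ) :
    ContinuousOn (familyFDeriv Φ) (fibre f ε r t₀ ×ˢ Metric.ball t₀ ρ) := by
  obtain ⟨V, hV, hsub, hΦ⟩ := hT.smooth
  exact (hΦ.continuousOn_fderiv_of_isOpen hV (by simp)).mono hsub

theorem continuousOn_uncurry (hT : IsLocalTrivialization f ε r t₀ ρ Φ Ψ) :
    ContinuousOn (fun p : Space n × ℂ => Φ p.1 p.2) (fibre f ε r t₀ ×ˢ Metric.ball t₀ ρ) :=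
  fun _ hp => (hT.hasFDerivAt hp.1 hp.2).continuousAt.continuousWithinAt

/-- The lift of a tangent vector `c` of the disc projects to `c`. -/
theorem fderiv_familyFDeriv_inr (hT : IsLocalTrivialization f ε r t₀ ρ Φ Ψ)
    (hf : IsGoodRepresentative f ε r) {x : Space n} (hx : x ∈ fibre f ε r t₀) {s : ℂ}
    (hs : s ∈ Metric.ball t₀ ρ) (c : ℂ) :
    fderiv ℂ f (Φ x s) (familyFDeriv Φ (x, s) (0, c)) = c := by
  have h1 : HasFDerivAt (fun s => Φ x s) _ s :=
    (hT.hasFDerivAt hx hs).comp s (hasFDerivAt_prodMk_right x s)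
  have h2 := ((hf.analytic_total _ (hT.mem_fibre x hx s hs).1).differentiableAt.hasFDerivAt
    |>.restrictScalars ℝ).comp s h1
  have h3 : HasFDerivAt (f ∘ fun s => Φ x s) (ContinuousLinearMap.id ℝ ℂ) s :=
    (hasFDerivAt_id s).congr_of_eventuallyEq <| by
      filter_upwards [Metric.isOpen_ball.mem_nhds hs] with z hz
      exact (hT.mem_fibre x hx z hz).2
  simpa using DFunLike.congr_fun (h2.unique h3) c

theorem hasFDerivWithinAt_slice (hT : IsLocalTrivialization f ε r t₀ ρ Φ Ψ) {k : ℕ}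
    {σ : Cube n k} (hσ : σ.IsSmooth) (hmem : ∀ y, σ y ∈ fibre f ε r t₀) {s : ℂ}
    (hs : s ∈ Metric.ball t₀ ρ) {y : Fin k → ℝ} (hy : y ∈ Icc (0 : Fin k → ℝ) 1) :
    HasFDerivWithinAt (fun y => Φ (σ.extend y) s)
      ((familyFDeriv Φ (σ.extend y, s)).comp ((ContinuousLinearMap.inl ℝ (Space n) ℂ).comp
        (fderivWithin ℝ σ.extend (Icc 0 1) y))) (Icc 0 1) y :=
  (hT.hasFDerivAt (σ.extend_mem hmem y) hs).comp_hasFDerivWithinAt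
    (f := fun y => (σ.extend y, s)) y
    ((hasFDerivAt_prodMk_left (𝕜 := ℝ) (σ.extend y) s).comp_hasFDerivWithinAt
      (f := σ.extend) y (hσ.differentiableOn y hy).hasFDerivWithinAt)

theorem fderiv_familyFDeriv_inl (hT : IsLocalTrivialization f ε r t₀ ρ Φ Ψ)
    (hf : IsGoodRepresentative f ε r) {k : ℕ} {σ : Cube n k} (hσ : σ.IsSmooth)
    (hmem : ∀ y, σ y ∈ fibre f ε r t₀) {s : ℂ} (hs : s ∈ Metric.ball t₀ ρ) {y : Fin k → ℝ}
    (hy : y ∈ Icc (0 : Fin k → ℝ) 1) (v : Fin k → ℝ) :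
    fderiv ℂ f (Φ (σ.extend y) s) (familyFDeriv Φ (σ.extend y, s)
      (fderivWithin ℝ σ.extend (Icc 0 1) y v, 0)) = 0 :=
  fderiv_apply_eq_zero_of_mem_fibre hf hy (hT.hasFDerivWithinAt_slice hσ hmem hs hy)
    (fun z _ => hT.mem_fibre _ (σ.extend_mem hmem z) s hs) v

end IsLocalTrivialization

/-! ### Prisms -/

/-- The prism over a cube along the path `γ` in the base. -/
def Cube.prism {n k : ℕ} (Φ : Space n → ℂ → Space n) (γ : ℝ → ℂ) (σ : Cube n k) :
    Cube n (k + 1) :=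
  fun y => Φ (σ (Fin.init y)) (γ (y (Fin.last k)))

theorem init_mem_unitBox {k : ℕ} {y : Fin (k + 1) → ℝ} (hy : y ∈ Icc (0 : Fin (k + 1) → ℝ) 1) :
    (Fin.init y : Fin k → ℝ) ∈ Icc (0 : Fin k → ℝ) 1 :=
  ⟨fun i => hy.1 i.castSucc, fun i => hy.2 i.castSucc⟩

theorem Cube.extend_prism {n k : ℕ} (Φ : Space n → ℂ → Space n) (γ : ℝ → ℂ) (σ : Cube n k)
    {y : Fin (k + 1) → ℝ} (hy : y ∈ Icc (0 : Fin (k + 1) → ℝ) 1) :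
    (σ.prism Φ γ).extend y = Φ (σ.extend (Fin.init y)) (γ (y (Fin.last k))) := by
  have : (projIcc (0 : ℝ) 1 zero_le_one (y (Fin.last k)) : ℝ) = y (Fin.last k) := by
    rw [projIcc_of_mem zero_le_one (⟨hy.1 _, hy.2 _⟩ : y (Fin.last k) ∈ Icc (0 : ℝ) 1)]
  unfold Cube.extend Cube.prism
  simp only [this]
  rfl

/-- Forgetting the last coordinate, as a continuous linear map. -/
def initCLM (k : ℕ) : (Fin (k + 1) → ℝ) →L[ℝ] (Fin k → ℝ) :=
  ContinuousLinearMap.pi fun i => ContinuousLinearMap.proj i.castSucc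

theorem initCLM_apply {k : ℕ} (y : Fin (k + 1) → ℝ) : initCLM k y = Fin.init y := rfl

namespace IsLocalTrivialization

variable {n : ℕ} {f : Space n → ℂ} {ε r : ℝ} {t₀ : ℂ} {ρ : ℝ} {Φ : Space n → ℂ → Space n}
  {Ψ : Space n → Space n}

open scoped ContDiff in
theorem isSmooth_prism (hT : IsLocalTrivialization f ε r t₀ ρ Φ Ψ) {k : ℕ} {σ : Cube n k}
    (hσ : σ.IsSmooth) (hmem : ∀ y, σ y ∈ fibre f ε r t₀) {γ : ℝ → ℂ} (hγ : ContDiff ℝ ∞ γ)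
    (hγm : ∀ τ ∈ Icc (0 : ℝ) 1, γ τ ∈ Metric.ball t₀ ρ) : (σ.prism Φ γ).IsSmooth := by
  obtain ⟨V, hV, hsub, hΦ⟩ := hT.smooth
  have h1 : ContDiffOn ℝ ∞ (fun y : Fin (k + 1) → ℝ => σ.extend (Fin.init y)) (Icc 0 1) :=
    hσ.contDiffOn.comp (initCLM k).contDiff.contDiffOn fun y hy => init_mem_unitBox hy
  have h2 : ContDiffOn ℝ ∞ (fun y : Fin (k + 1) → ℝ => γ (y (Fin.last k))) (Icc 0 1) :=
    (hγ.comp (contDiff_apply ℝ ℝ (Fin.last k))).contDiffOn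
  have h3 := hΦ.comp (h1.prodMk h2) fun y hy =>
    hsub ⟨σ.extend_mem hmem _, hγm _ ⟨hy.1 _, hy.2 _⟩⟩
  exact ContDiffOn.congr h3 fun y hy => Cube.extend_prism Φ γ σ hy

theorem fderivWithin_prism (hT : IsLocalTrivialization f ε r t₀ ρ Φ Ψ) {k : ℕ} {σ : Cube n k}
    (hσ : σ.IsSmooth) (hmem : ∀ y, σ y ∈ fibre f ε r t₀) {γ : ℝ → ℂ} (hγ : Differentiable ℝ γ)
    (hγm : ∀ τ ∈ Icc (0 : ℝ) 1, γ τ ∈ Metric.ball t₀ ρ) {y : Fin (k + 1) → ℝ}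
    (hy : y ∈ Icc (0 : Fin (k + 1) → ℝ) 1) (v : Fin (k + 1) → ℝ) :
    fderivWithin ℝ (σ.prism Φ γ).extend (Icc 0 1) y v =
      familyFDeriv Φ (σ.extend (Fin.init y), γ (y (Fin.last k)))
        (fderivWithin ℝ σ.extend (Icc 0 1) (Fin.init y) (Fin.init v),
          v (Fin.last k) • deriv γ (y (Fin.last k))) := by
  have h1 : HasFDerivWithinAt (fun y : Fin (k + 1) → ℝ => σ.extend (initCLM k y)) _ (Icc 0 1) y :=
    HasFDerivWithinAt.comp (g := σ.extend) (f := initCLM k) y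
      (hσ.differentiableOn (Fin.init y) (init_mem_unitBox hy)).hasFDerivWithinAt
      (initCLM k).hasFDerivWithinAt fun y hy => init_mem_unitBox hy
  have h2 : HasFDerivWithinAt (fun y : Fin (k + 1) → ℝ => γ (y (Fin.last k))) _ (Icc 0 1) y :=
    (hγ (y (Fin.last k))).hasDerivAt.hasFDerivAt.comp_hasFDerivWithinAt y
      (hasFDerivAt_apply (𝕜 := ℝ) (Fin.last k) y).hasFDerivWithinAt
  have h3 := (hT.hasFDerivAt (σ.extend_mem hmem (Fin.init y))
    (hγm _ ⟨hy.1 (Fin.last k), hy.2 (Fin.last k)⟩)).comp_hasFDerivWithinAt y (h1.prodMk h2)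
  have h4 := h3.congr (fun z hz => Cube.extend_prism Φ γ σ hz) (Cube.extend_prism Φ γ σ hy)
  rw [h4.fderivWithin (uniqueDiffOn_unitBox _ y hy)]
  simp [initCLM_apply]

end IsLocalTrivialization

/-! ### The Gelfand–Leray integrand -/

/-- The contraction of an `(n+1)`-form with the lift of `∂/∂s`, pulled back along a cube that is
transported to the fibre over `s`. -/
def Cube.lerayIntegrand {n : ℕ} (Φ : Space n → ℂ → Space n) (ω : DiffForm n (n + 1))
    (σ : Cube n n) (s : ℂ) (y : Fin n → ℝ) : ℂ :=
  ω (Φ (σ.extend y) s) (Fin.snoc (fun i : Fin n => familyFDeriv Φ (σ.extend y, s)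
      (fderivWithin ℝ σ.extend (Icc 0 1) y (Pi.single i 1), 0))
    (familyFDeriv Φ (σ.extend y, s) (0, 1)) : Fin (n + 1) → Space n)

/-- The integral of the Gelfand–Leray residue of `ω` over the transported cube. -/
def Cube.leray {n : ℕ} (Φ : Space n → ℂ → Space n) (ω : DiffForm n (n + 1))
    (σ : Cube n n) (s : ℂ) : ℂ :=
  ∫ y in Icc (0 : Fin n → ℝ) 1, σ.lerayIntegrand Φ ω s y

theorem continuousOn_form_apply {X : Type*} [TopologicalSpace X] {n p : ℕ} {S : Set X}
    {g : X → (Space n) [⋀^Fin p]→L[ℂ] ℂ} {v : X → Fin p → Space n}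
    (hg : ContinuousOn g S) (hv : ContinuousOn v S) : ContinuousOn (fun x => g x (v x)) S := by
  have h : Continuous fun q : ((Space n) [⋀^Fin p]→L[ℂ] ℂ) × (Fin p → Space n) => q.1 q.2 := by
    refine Differentiable.continuous (𝕜 := ℂ) fun q => ?_
    have h1 : DifferentiableAt ℂ
        (Prod.fst : ((Space n) [⋀^Fin p]→L[ℂ] ℂ) × (Fin p → Space n) → _) q :=
      differentiableAt_fst
    have h2 : ∀ i, DifferentiableAt ℂ
        (fun q : ((Space n) [⋀^Fin p]→L[ℂ] ℂ) × (Fin p → Space n) => q.2 i) q :=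
      fun i => differentiableAt_pi.1 differentiableAt_snd i
    exact DifferentiableAt.continuousAlternatingMap_apply h1 h2
  exact h.comp_continuousOn (hg.prodMk hv)

/-- The path parameter of a prism is its last coordinate. Integrating it outermost leaves an inner
integral over a cube in a single fibre. -/
theorem setIntegral_unitBox_succ {n : ℕ} {g : (Fin (n + 1) → ℝ) → ℂ}
    (hg : ContinuousOn g (Icc 0 1)) :
    ∫ y in Icc (0 : Fin (n + 1) → ℝ) 1, g y =
      ∫ τ in Icc (0 : ℝ) 1, ∫ y in Icc (0 : Fin n → ℝ) 1, g (Fin.snoc y τ) := by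
  set e : ℝ × (Fin n → ℝ) ≃ᵐ (Fin (n + 1) → ℝ) :=
    (MeasurableEquiv.piFinSuccAbove (fun _ => ℝ) (Fin.last n)).symm with he
  have hem : MeasurePreserving e :=
    (volume_preserving_piFinSuccAbove (fun _ : Fin (n + 1) => ℝ) (Fin.last n)).symm _
  have hee : ∀ p, e p = Fin.snoc p.2 p.1 := fun p => by
    rw [he, MeasurableEquiv.piFinSuccAbove_symm_apply]
    simp [Fin.insertNthEquiv]
  have hpre : e ⁻¹' Icc 0 1 = Icc (0 : ℝ) 1 ×ˢ Icc (0 : Fin n → ℝ) 1 :=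
    ((Fin.insertNthOrderIso (fun _ => ℝ) (Fin.last n)).preimage_Icc _ _).trans (Icc_prod_eq _ _)
  have hint : IntegrableOn g (Icc 0 1) := hg.integrableOn_compact isCompact_Icc
  have hint' : IntegrableOn (g ∘ e) (e ⁻¹' Icc 0 1) :=
    (hem.integrableOn_comp_preimage e.measurableEmbedding).2 hint
  rw [← hem.setIntegral_preimage_emb e.measurableEmbedding, hpre, Measure.volume_eq_prod,
    setIntegral_prod _ (by rw [← hpre, ← Measure.volume_eq_prod]; exact hint')]
  simp only [hee]

namespace IsLocalTrivialization

variable {n : ℕ} {f : Space n → ℂ} {ε r : ℝ} {t₀ : ℂ} {ρ : ℝ} {Φ : Space n → ℂ → Space n}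
  {Ψ : Space n → Space n}

theorem continuousOn_lerayIntegrand (hT : IsLocalTrivialization f ε r t₀ ρ Φ Ψ)
    {ω : DiffForm n (n + 1)} (hω : ContinuousOn ω (total f ε r)) {σ : Cube n n}
    (hσ : σ.IsSmooth) (hmem : ∀ y, σ y ∈ fibre f ε r t₀) :
    ContinuousOn (fun p : ℂ × (Fin n → ℝ) => σ.lerayIntegrand Φ ω p.1 p.2)
      (Metric.ball t₀ ρ ×ˢ Icc 0 1) := by
  have h0 : ContinuousOn (fun p : ℂ × (Fin n → ℝ) => σ.extend p.2)
      (Metric.ball t₀ ρ ×ˢ Icc 0 1) :=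
    hσ.contDiffOn.continuousOn.comp continuousOn_snd fun p hp => hp.2
  have h1 : ContinuousOn (fun p : ℂ × (Fin n → ℝ) => (σ.extend p.2, p.1))
      (Metric.ball t₀ ρ ×ˢ Icc 0 1) := h0.prodMk continuousOn_fst
  have hm : MapsTo (fun p : ℂ × (Fin n → ℝ) => (σ.extend p.2, p.1))
      (Metric.ball t₀ ρ ×ˢ Icc 0 1) (fibre f ε r t₀ ×ˢ Metric.ball t₀ ρ) :=
    fun p hp => ⟨σ.extend_mem hmem _, hp.1⟩
  have h2 := hT.continuousOn_familyFDeriv.comp h1 hm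
  have h3 := hT.continuousOn_uncurry.comp h1 hm
  have h4 : ContinuousOn (fun y => fderivWithin ℝ σ.extend (Icc 0 1) y) (Icc 0 1) :=
    hσ.contDiffOn.continuousOn_fderivWithin (uniqueDiffOn_unitBox n) (by simp)
  have h5 : ContinuousOn (fun p : ℂ × (Fin n → ℝ) => fderivWithin ℝ σ.extend (Icc 0 1) p.2)
      (Metric.ball t₀ ρ ×ˢ Icc 0 1) := h4.comp continuousOn_snd fun p hp => hp.2
  refine continuousOn_form_apply (hω.comp h3 fun p hp => ?_) ?_
  · exact (hT.mem_fibre _ (σ.extend_mem hmem _) _ hp.1).1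
  · rw [continuousOn_pi]
    intro i
    refine Fin.lastCases ?_ (fun j => ?_) i
    · simp only [Fin.snoc_last]
      exact h2.clm_apply continuousOn_const
    · simp only [Fin.snoc_castSucc]
      exact h2.clm_apply ((h5.clm_apply continuousOn_const).prodMk continuousOn_const)

theorem continuousOn_leray (hT : IsLocalTrivialization f ε r t₀ ρ Φ Ψ)
    {ω : DiffForm n (n + 1)} (hω : ContinuousOn ω (total f ε r)) {σ : Cube n n}
    (hσ : σ.IsSmooth) (hmem : ∀ y, σ y ∈ fibre f ε r t₀) :
    ContinuousOn (σ.leray Φ ω) (Metric.ball t₀ ρ) := by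
  have hc := hT.continuousOn_lerayIntegrand hω hσ hmem
  -- Clamping to the box extends the integrand to a jointly continuous function on all of `ℝ^n`, as
  -- the theorem on parametric integrals requires; on the box nothing changes.
  set cl : (Fin n → ℝ) → (Fin n → ℝ) := fun y i => projIcc (0 : ℝ) 1 zero_le_one (y i) with hcl
  have hcl_cont : Continuous cl := continuous_pi fun i =>
    continuous_subtype_val.comp (continuous_projIcc.comp (continuous_apply i))
  have hcl_mem : ∀ y, cl y ∈ Icc (0 : Fin n → ℝ) 1 := fun y =>
    ⟨fun i => (projIcc (0 : ℝ) 1 zero_le_one (y i)).2.1,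
      fun i => (projIcc (0 : ℝ) 1 zero_le_one (y i)).2.2⟩
  have hcl_eq : ∀ y ∈ Icc (0 : Fin n → ℝ) 1, cl y = y := fun y hy => funext fun i => by
    simp only [hcl]
    rw [projIcc_of_mem zero_le_one (⟨hy.1 i, hy.2 i⟩ : y i ∈ Icc (0 : ℝ) 1)]
  have : LocallyCompactSpace (Metric.ball t₀ ρ) := Metric.isOpen_ball.locallyCompactSpace
  have hcont : Continuous (Function.uncurry fun (s : Metric.ball t₀ ρ) (y : Fin n → ℝ) =>
      σ.lerayIntegrand Φ ω s (cl y)) :=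
    hc.comp_continuous (f := fun p : Metric.ball t₀ ρ × (Fin n → ℝ) => ((p.1 : ℂ), cl p.2))
      ((continuous_subtype_val.comp continuous_fst).prodMk (hcl_cont.comp continuous_snd))
      fun p => ⟨p.1.2, hcl_mem _⟩
  rw [continuousOn_iff_continuous_domRestrict]
  refine (continuous_parametric_integral_of_continuous (μ := volume) hcont
    (isCompact_Icc (a := (0 : Fin n → ℝ)) (b := 1))).congr fun s => ?_
  exact setIntegral_congr_fun measurableSet_Icc fun y hy => by simp only [hcl_eq y hy]

/-- Integration of `h(f) ω` over a prism reduces to an integral over the path. -/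
theorem integral_prism (hT : IsLocalTrivialization f ε r t₀ ρ Φ Ψ)
    (hf : IsGoodRepresentative f ε r) {ω : DiffForm n (n + 1)}
    (hω : ContinuousOn ω (total f ε r)) {σ : Cube n n}
    (hσ : σ.IsSmooth) (hmem : ∀ y, σ y ∈ fibre f ε r t₀) {γ : ℝ → ℂ} (hγ : ContDiff ℝ 1 γ)
    (hγm : ∀ τ ∈ Icc (0 : ℝ) 1, γ τ ∈ Metric.ball t₀ ρ) {h : ℂ → ℂ}
    (hh : ContinuousOn (fun τ => h (γ τ)) (Icc 0 1)) :
    (σ.prism Φ γ).integral (fun x => h (f x) • ω x) =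
      ∫ τ in (0 : ℝ)..1, h (γ τ) * deriv γ τ * σ.leray Φ ω (γ τ) := by
  have hlast : ∀ y ∈ Icc (0 : Fin (n + 1) → ℝ) 1, y (Fin.last n) ∈ Icc (0 : ℝ) 1 :=
    fun y hy => ⟨hy.1 _, hy.2 _⟩
  set g : (Fin (n + 1) → ℝ) → ℂ := fun y => h (γ (y (Fin.last n))) * deriv γ (y (Fin.last n)) *
    σ.lerayIntegrand Φ ω (γ (y (Fin.last n))) (Fin.init y) with hg
  have hgc : ContinuousOn g (Icc 0 1) := by
    have hl : ContinuousOn (fun y : Fin (n + 1) → ℝ => y (Fin.last n)) (Icc 0 1) :=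
      (continuous_apply (Fin.last n)).continuousOn
    refine ((hh.comp hl hlast).mul
      ((hγ.continuous_deriv le_rfl).comp_continuousOn hl)).mul ?_
    exact (hT.continuousOn_lerayIntegrand hω hσ hmem).comp
      (f := fun y : Fin (n + 1) → ℝ => (γ (y (Fin.last n)), (Fin.init y : Fin n → ℝ)))
      ((hγ.continuous.comp_continuousOn hl).prodMk (initCLM n).continuous.continuousOn)
      fun y hy => ⟨hγm _ (hlast y hy), init_mem_unitBox hy⟩
  have hpt : ∀ y ∈ Icc (0 : Fin (n + 1) → ℝ) 1,
      (h (f ((σ.prism Φ γ).extend y)) • ω ((σ.prism Φ γ).extend y))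
        (fun i => fderivWithin ℝ (σ.prism Φ γ).extend (Icc 0 1) y (Pi.single i 1)) = g y := by
    intro y hy
    have hx := σ.extend_mem hmem (Fin.init y)
    have hs := hγm _ (hlast y hy)
    have hvec : (fun i => fderivWithin ℝ (σ.prism Φ γ).extend (Icc 0 1) y (Pi.single i 1)) =
        (Fin.snoc (fun i : Fin n =>
          familyFDeriv Φ (σ.extend (Fin.init y), γ (y (Fin.last n)))
            (fderivWithin ℝ σ.extend (Icc 0 1) (Fin.init y) (Pi.single i 1), 0))
          (familyFDeriv Φ (σ.extend (Fin.init y), γ (y (Fin.last n)))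
            (0, deriv γ (y (Fin.last n)))) : Fin (n + 1) → Space n) := by
      funext i
      rw [hT.fderivWithin_prism hσ hmem (hγ.differentiable (by simp)) hγm hy]
      refine Fin.lastCases ?_ (fun j => ?_) i
      · have : (Fin.init (Pi.single (Fin.last n) (1 : ℝ) : Fin (n + 1) → ℝ) : Fin n → ℝ) = 0 := by
          funext l
          simp [Fin.init, (Fin.castSucc_lt_last l).ne]
        simp [this]
      · have : (Fin.init (Pi.single j.castSucc (1 : ℝ) : Fin (n + 1) → ℝ) : Fin n → ℝ) =
            Pi.single j 1 := by
          funext l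
          simp [Fin.init, Pi.single_apply]
        simp [this, (Fin.castSucc_lt_last j).ne']
    -- The last tangent vector lifts `γ'` and the others are vertical, so it may be replaced by the
    -- lift of `1` at the cost of the factor `γ'`.
    rw [hvec, Cube.extend_prism Φ γ σ hy, (hT.mem_fibre _ hx _ hs).2,
      ContinuousAlternatingMap.smul_apply,
      topForm_snoc_eq_mul (L := fderiv ℂ f (Φ (σ.extend (Fin.init y)) (γ (y (Fin.last n))))) _
        (fun i => hT.fderiv_familyFDeriv_inl hf hσ hmem hs (init_mem_unitBox hy) _)
        (hT.fderiv_familyFDeriv_inr hf hx hs 1) (hT.fderiv_familyFDeriv_inr hf hx hs _),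
      smul_eq_mul, ← mul_assoc]
    rfl
  have h1 : (σ.prism Φ γ).integral (fun x => h (f x) • ω x) =
      ∫ y in Icc (0 : Fin (n + 1) → ℝ) 1, g y := setIntegral_congr_fun measurableSet_Icc hpt
  rw [h1, setIntegral_unitBox_succ hgc, intervalIntegral.integral_of_le zero_le_one,
    ← integral_Icc_eq_integral_Ioc]
  refine setIntegral_congr_fun measurableSet_Icc fun τ _ => ?_
  simp only [hg, Fin.snoc_last, Fin.init_snoc, Cube.leray, integral_const_mul]

end IsLocalTrivialization

/-! ### Boundaries of prisms -/

theorem Cube.face_castSucc_prism {n k : ℕ} (Φ : Space n → ℂ → Space n) (γ : ℝ → ℂ)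
    (σ : Cube n (k + 1)) (i : Fin (k + 1)) (e : unitInterval) :
    (σ.prism Φ γ).face i.castSucc e = (σ.face i e).prism Φ γ := by
  funext y
  have h1 : (Fin.init (i.castSucc.insertNth e y : Fin (k + 2) → unitInterval) :
      Fin (k + 1) → unitInterval) = i.insertNth e (Fin.init y : Fin k → unitInterval) := by
    funext j
    refine Fin.succAboveCases i ?_ (fun l => ?_) j
    · simp [Fin.init]
    · rw [Fin.insertNth_apply_succAbove, Fin.init, ← Fin.castSucc_succAbove_castSucc,
        Fin.insertNth_apply_succAbove]
      rfl
  have h2 : (i.castSucc.insertNth e y : Fin (k + 2) → unitInterval) (Fin.last (k + 1)) =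
      y (Fin.last k) := by
    have : i.castSucc.succAbove (Fin.last k) = Fin.last (k + 1) :=
      Fin.succAbove_of_le_castSucc _ _ (Fin.castSucc_le_castSucc_iff.2 (Fin.le_last i))
    rw [← this, Fin.insertNth_apply_succAbove]
  unfold Cube.face Cube.prism
  rw [h1, h2]

theorem Cube.face_last_prism {n k : ℕ} (Φ : Space n → ℂ → Space n) (γ : ℝ → ℂ)
    (σ : Cube n k) (e : unitInterval) :
    (σ.prism Φ γ).face (Fin.last k) e = fun y => Φ (σ y) (γ e) := by
  funext y
  simp [Cube.face, Cube.prism]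

theorem Cube.IsDegenerate.prism {n k : ℕ} {Φ : Space n → ℂ → Space n} {γ : ℝ → ℂ}
    {σ : Cube n k} (hσ : σ.IsDegenerate) : (σ.prism Φ γ).IsDegenerate := by
  obtain ⟨i, hi⟩ := hσ
  refine ⟨i.castSucc, fun y e => ?_⟩
  have h1 : (Fin.init (Function.update y i.castSucc e) : Fin k → unitInterval) =
      Function.update (Fin.init y) i e := Fin.init_update_castSucc _ _ _
  have h2 : Function.update y i.castSucc e (Fin.last k) = y (Fin.last k) :=
    Function.update_of_ne (Fin.castSucc_lt_last i).ne' _ _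
  unfold Cube.prism
  rw [h1, h2, hi]

/-- The lateral faces of the prism over `c` make up the prism over `∂c`, which is degenerate because
`∂c` is. In degree `0` there are no lateral faces. -/
theorem Chain.sum_prism_faces_eq_zero {n : ℕ} (Φ : Space n → ℂ → Space n) (γ : ℝ → ℂ) :
    ∀ {k : ℕ} {c : Chain n k}, c.IsCycle → ∀ α : DiffForm n k,
    (c.sum fun σ a => (a : ℂ) * ∑ i : Fin k, (-1) ^ (i : ℕ) *
      (((σ.prism Φ γ).face i.castSucc 1).integral α -
        ((σ.prism Φ γ).face i.castSucc 0).integral α)) = 0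
  | 0, c, _, α => by simp
  | k + 1, c, hc, α => by
    have h1 : Chain.integral (Finsupp.mapDomain (Cube.prism Φ γ) c.boundary) α = 0 := by
      rw [Chain.integral_mapDomain]
      exact Finset.sum_eq_zero fun σ hσ => by
        simp only [(Cube.IsDegenerate.prism (hc σ hσ)).integral_eq_zero, mul_zero]
    have h2 : Chain.integral (Finsupp.mapDomain (Cube.prism Φ γ) c.boundary) α =
        ((Chain.integralHom α).comp (Finsupp.mapDomain.addMonoidHom (Cube.prism Φ γ)))
          c.boundary := rfl
    rw [← h1, h2, Chain.boundary, Finsupp.sum, Finsupp.sum, map_sum]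
    refine Finset.sum_congr rfl fun σ _ => ?_
    rw [map_zsmul, map_sum, zsmul_eq_mul]
    congr 1
    refine Finset.sum_congr rfl fun i _ => ?_
    rw [map_zsmul, map_sub, zsmul_eq_mul]
    simp only [AddMonoidHom.comp_apply, Finsupp.mapDomain.addMonoidHom_apply,
      Finsupp.mapDomain_single, Chain.integralHom_apply, Chain.integral_single,
      Cube.face_castSucc_prism]
    push_cast
    ring

theorem Chain.integral_map {n k : ℕ} (g : Space n → Space n) (c : Chain n k) (α : DiffForm n k) :
    (c.map g).integral α = c.sum fun σ a => (a : ℂ) * Cube.integral (fun y => g (σ y)) α :=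
  Chain.integral_mapDomain _ c α

/-- The lateral faces contribute nothing, so only the two ends remain. The path coordinate has index
`k`, whence the sign. -/
theorem Chain.IsCycle.integral_boundary_prism {n k : ℕ} {c : Chain n k} (hc : c.IsCycle)
    (Φ : Space n → ℂ → Space n) (γ : ℝ → ℂ) (α : DiffForm n k) :
    Chain.integral (Chain.boundary (Finsupp.mapDomain (Cube.prism Φ γ) c)) α =
      (-1) ^ k * ((c.map fun x => Φ x (γ 1)).integral α -
        (c.map fun x => Φ x (γ 0)).integral α) := by
  rw [Chain.integral_boundary, Finsupp.sum_mapDomain_index (by simp) (by intros; push_cast; ring),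
    Chain.integral_map, Chain.integral_map]
  simp only [Fin.sum_univ_castSucc, mul_add, Fin.val_castSucc, Fin.val_last,
    Cube.face_last_prism]
  rw [Finsupp.sum_add, Chain.sum_prism_faces_eq_zero Φ γ hc α, zero_add]
  simp only [Finsupp.sum, ← Finset.sum_sub_distrib, Finset.mul_sum]
  refine Finset.sum_congr rfl fun σ _ => ?_
  simp only [Icc.coe_one, Icc.coe_zero]
  ring

/-! ### The Gelfand–Leray period -/

/-- The integral of the Gelfand–Leray residue over a transported chain. -/
def Chain.leray {n : ℕ} (Φ : Space n → ℂ → Space n) (ω : DiffForm n (n + 1)) (c : Chain n n)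
    (s : ℂ) : ℂ :=
  c.sum fun σ a => (a : ℂ) * σ.leray Φ ω s

/-- A continuous function that is the mean of the difference quotients of `F` along segments is
the derivative of `F`. -/
theorem hasDerivAt_of_segment_integral {U : Set ℂ} (hU : IsOpen U) {F K : ℂ → ℂ}
    (hK : ContinuousOn K U) {s₀ : ℂ} (hs₀ : s₀ ∈ U)
    (hF : ∀ᶠ s in 𝓝 s₀, F s - F s₀ = (s - s₀) * ∫ τ in (0 : ℝ)..1, K (s₀ + τ * (s - s₀))) :
    HasDerivAt F (K s₀) s₀ := by
  rw [hasDerivAt_iff_isLittleO, Asymptotics.isLittleO_iff]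
  intro e he
  have hKs := hK.continuousAt (hU.mem_nhds hs₀)
  obtain ⟨d, hd, hball⟩ := Metric.mem_nhds_iff.1 (inter_mem (hU.mem_nhds hs₀)
    (hKs.preimage_mem_nhds (Metric.closedBall_mem_nhds (K s₀) he)))
  filter_upwards [hF, Metric.ball_mem_nhds s₀ hd] with s hs hsd
  have hseg : ∀ τ ∈ Icc (0 : ℝ) 1, s₀ + τ * (s - s₀) ∈ Metric.ball s₀ d := by
    intro τ hτ
    rw [mem_ball_iff_norm] at hsd ⊢
    rw [add_sub_cancel_left, norm_mul, Complex.norm_real, Real.norm_of_nonneg hτ.1]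
    exact lt_of_le_of_lt (mul_le_of_le_one_left (norm_nonneg _) hτ.2) hsd
  have hint : IntervalIntegrable (fun τ : ℝ => K (s₀ + τ * (s - s₀))) volume 0 1 := by
    refine ContinuousOn.intervalIntegrable ?_
    rw [uIcc_of_le zero_le_one]
    exact hK.comp (by fun_prop) fun τ hτ => (hball (hseg τ hτ)).1
  have h1 : F s - F s₀ - (s - s₀) • K s₀ =
      (s - s₀) * ∫ τ in (0 : ℝ)..1, (K (s₀ + τ * (s - s₀)) - K s₀) := by
    rw [intervalIntegral.integral_sub hint intervalIntegrable_const, hs]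
    simp [mul_sub]
  have h2 : ‖∫ τ in (0 : ℝ)..1, (K (s₀ + τ * (s - s₀)) - K s₀)‖ ≤ e * |(1 : ℝ) - 0| := by
    refine intervalIntegral.norm_integral_le_of_norm_le_const fun τ hτ => ?_
    rw [uIoc_of_le zero_le_one] at hτ
    have := (hball (hseg τ ⟨hτ.1.le, hτ.2⟩)).2
    rwa [mem_preimage, mem_closedBall_iff_norm] at this
  rw [h1, norm_mul, mul_comm]
  exact mul_le_mul_of_nonneg_right (by simpa using h2) (norm_nonneg _)

namespace IsLocalTrivialization

variable {n : ℕ} {f : Space n → ℂ} {ε r : ℝ} {t₀ : ℂ} {ρ : ℝ} {Φ : Space n → ℂ → Space n}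
  {Ψ : Space n → Space n}

/-- The lift of `∂/∂s` has `df = 1` and the remaining arguments are vertical, so the contraction
leaves `η` restricted to the fibre. The sign comes from placing the lift last. -/
theorem leray_dWedge (hT : IsLocalTrivialization f ε r t₀ ρ Φ Ψ)
    (hf : IsGoodRepresentative f ε r) (η : DiffForm n n) {c : Chain n n}
    (hc : c.IsSmoothIn (fibre f ε r t₀)) {s : ℂ} (hs : s ∈ Metric.ball t₀ ρ) :
    c.leray Φ (dWedge f η) s = (-1) ^ n * (c.map fun x => Φ x s).integral η := by
  rw [Chain.integral_map, Chain.leray, Finsupp.sum, Finsupp.sum, Finset.mul_sum]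
  refine Finset.sum_congr rfl fun σ hσ => ?_
  obtain ⟨hsm, hmem⟩ := hc σ hσ
  rw [mul_left_comm]
  congr 1
  rw [Cube.leray, Cube.integral, ← integral_const_mul]
  refine setIntegral_congr_fun measurableSet_Icc fun y hy => ?_
  simp only [Cube.lerayIntegrand]
  rw [dWedge_snoc f η _ fun i => hT.fderiv_familyFDeriv_inl hf hsm hmem hs hy _,
    hT.fderiv_familyFDeriv_inr hf (σ.extend_mem hmem y) hs, one_mul]
  have h1 : Cube.extend (fun y => Φ (σ y) s) = fun y => Φ (σ.extend y) s := rfl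
  rw [h1, (hT.hasFDerivWithinAt_slice hsm hmem hs hy).fderivWithin (uniqueDiffOn_unitBox n y hy)]
  rfl

theorem continuousOn_chain_leray (hT : IsLocalTrivialization f ε r t₀ ρ Φ Ψ)
    {ω : DiffForm n (n + 1)} (hω : ContinuousOn ω (total f ε r)) {c : Chain n n}
    (hc : c.IsSmoothIn (fibre f ε r t₀)) :
    ContinuousOn (c.leray Φ ω) (Metric.ball t₀ ρ) :=
  continuousOn_finsetSum _ fun σ hσ =>
    continuousOn_const.mul (hT.continuousOn_leray hω (hc σ hσ).1 (hc σ hσ).2)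

theorem integral_chain_prism (hT : IsLocalTrivialization f ε r t₀ ρ Φ Ψ)
    (hf : IsGoodRepresentative f ε r) {ω : DiffForm n (n + 1)}
    (hω : ContinuousOn ω (total f ε r)) {c : Chain n n}
    (hc : c.IsSmoothIn (fibre f ε r t₀)) {γ : ℝ → ℂ} (hγ : ContDiff ℝ 1 γ)
    (hγm : ∀ τ ∈ Icc (0 : ℝ) 1, γ τ ∈ Metric.ball t₀ ρ) {h : ℂ → ℂ}
    (hh : ContinuousOn (fun τ => h (γ τ)) (Icc 0 1)) :
    Chain.integral (Finsupp.mapDomain (Cube.prism Φ γ) c) (fun x => h (f x) • ω x) =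
      ∫ τ in (0 : ℝ)..1, h (γ τ) * deriv γ τ * c.leray Φ ω (γ τ) := by
  rw [Chain.integral_mapDomain, Finsupp.sum]
  simp only [Chain.leray, Finsupp.sum, Finset.mul_sum]
  rw [intervalIntegral.integral_finsetSum]
  · refine Finset.sum_congr rfl fun σ hσ => ?_
    rw [hT.integral_prism hf hω (hc σ hσ).1 (hc σ hσ).2 hγ hγm hh,
      ← intervalIntegral.integral_const_mul]
    congr 1
    funext τ
    ring
  · intro σ hσ
    refine ContinuousOn.intervalIntegrable ?_
    rw [uIcc_of_le zero_le_one]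
    exact (hh.mul (hγ.continuous_deriv le_rfl).continuousOn).mul
      (continuousOn_const.mul ((hT.continuousOn_leray hω (hc σ hσ).1 (hc σ hσ).2).comp
        hγ.continuous.continuousOn hγm))

open scoped ContDiff in
/-- The period of an `n`-form over a transported cycle is complex differentiable. -/
theorem hasDerivAt_integral_map (hT : IsLocalTrivialization f ε r t₀ ρ Φ Ψ)
    (hf : IsGoodRepresentative f ε r) {η : DiffForm n n} (hη : AnalyticOnNhd ℂ η (total f ε r))
    {c : Chain n n} (hc : c.IsSmoothIn (fibre f ε r t₀)) (hcyc : c.IsCycle) {s : ℂ}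
    (hs : s ∈ Metric.ball t₀ ρ) :
    HasDerivAt (fun s => (c.map fun x => Φ x s).integral η)
      ((-1) ^ n * c.leray Φ (extDeriv η) s) s := by
  have hω := (analyticOnNhd_extDeriv hη).continuousOn
  refine hasDerivAt_of_segment_integral (K := fun s => (-1) ^ n * c.leray Φ (extDeriv η) s)
    Metric.isOpen_ball (continuousOn_const.mul (hT.continuousOn_chain_leray hω hc)) hs ?_
  filter_upwards [Metric.isOpen_ball.mem_nhds hs] with s' hs'
  set γ : ℝ → ℂ := fun τ => s + τ * (s' - s) with hγ
  have hγc : ContDiff ℝ ∞ γ :=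
    contDiff_const.add (Complex.ofRealCLM.contDiff.mul contDiff_const)
  have hγd : ∀ τ, deriv γ τ = s' - s := fun τ => by
    have : HasDerivAt γ (1 * (s' - s)) τ :=
      ((Complex.ofRealCLM.hasDerivAt (x := τ)).mul_const (s' - s)).const_add s
    rw [this.deriv, one_mul]
  have hγm : ∀ τ ∈ Icc (0 : ℝ) 1, γ τ ∈ Metric.ball t₀ ρ := fun τ hτ => by
    have := (convex_ball t₀ ρ).add_smul_sub_mem hs hs' hτ
    simpa [hγ] using this
  have hsm : Chain.IsSmoothIn (Finsupp.mapDomain (Cube.prism Φ γ) c) (total f ε r) := by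
    intro σ' hσ'
    classical
    obtain ⟨σ, hσ, rfl⟩ := Finset.mem_image.1 (Finsupp.mapDomain_support hσ')
    exact ⟨hT.isSmooth_prism (hc σ hσ).1 (hc σ hσ).2 hγc hγm, fun y =>
      (hT.mem_fibre _ ((hc σ hσ).2 _) _ (hγm _ (y (Fin.last n)).2)).1⟩
  -- Stokes on the prism over the segment: the boundary side is `(-1)^n` times the increment of the
  -- period, the interior side `(s' - s) ∫ L_{dη}`. The complex factor `s' - s = γ'` is what makes
  -- the derivative complex.
  have h1 := hsm.integral_boundary hη
  have h2 := hT.integral_chain_prism hf hω hc (hγc.of_le (by simp)) hγm (h := fun _ => 1)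
    continuousOn_const
  simp only [one_smul, one_mul, hγd] at h2
  rw [hcyc.integral_boundary_prism, h2, intervalIntegral.integral_const_mul] at h1
  have h3 : γ 1 = s' := by simp [hγ]
  have h4 : γ 0 = s := by simp [hγ]
  rw [h3, h4] at h1
  rw [intervalIntegral.integral_const_mul, mul_left_comm, ← h1, ← mul_assoc, ← mul_pow]
  simp

theorem differentiableOn_integral_map (hT : IsLocalTrivialization f ε r t₀ ρ Φ Ψ)
    (hf : IsGoodRepresentative f ε r) {η : DiffForm n n} (hη : AnalyticOnNhd ℂ η (total f ε r))
    {c : Chain n n} (hc : c.IsSmoothIn (fibre f ε r t₀)) (hcyc : c.IsCycle) :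
    DifferentiableOn ℂ (fun s => (c.map fun x => Φ x s).integral η) (Metric.ball t₀ ρ) :=
  fun _ hs => (hT.hasDerivAt_integral_map hf hη hc hcyc hs).differentiableAt.differentiableWithinAt

theorem differentiableOn_leray_dWedge (hT : IsLocalTrivialization f ε r t₀ ρ Φ Ψ)
    (hf : IsGoodRepresentative f ε r) {η : DiffForm n n} (hη : AnalyticOnNhd ℂ η (total f ε r))
    {c : Chain n n} (hc : c.IsSmoothIn (fibre f ε r t₀)) (hcyc : c.IsCycle) :
    DifferentiableOn ℂ (c.leray Φ (dWedge f η)) (Metric.ball t₀ ρ) :=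
  ((hT.differentiableOn_integral_map hf hη hc hcyc).const_mul _).congr fun _ hs =>
    hT.leray_dWedge hf η hc hs

/-- Up to sign this is the derivative of the holomorphic function `s ↦ ∫_{c_s} η`, hence itself
holomorphic. -/
theorem differentiableOn_leray_extDeriv (hT : IsLocalTrivialization f ε r t₀ ρ Φ Ψ)
    (hf : IsGoodRepresentative f ε r) {η : DiffForm n n} (hη : AnalyticOnNhd ℂ η (total f ε r))
    {c : Chain n n} (hc : c.IsSmoothIn (fibre f ε r t₀)) (hcyc : c.IsCycle) :
    DifferentiableOn ℂ (c.leray Φ (extDeriv η)) (Metric.ball t₀ ρ) := by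
  refine (((hT.differentiableOn_integral_map hf hη hc hcyc).deriv
    Metric.isOpen_ball).const_mul ((-1) ^ n)).congr fun s hs => ?_
  rw [(hT.hasDerivAt_integral_map hf hη hc hcyc hs).deriv, ← mul_assoc, ← mul_pow]
  simp

/-- The residue formula for a tube. -/
theorem integral_tube (hT : IsLocalTrivialization f ε r t₀ ρ Φ Ψ)
    (hf : IsGoodRepresentative f ε r) {ω : DiffForm n (n + 1)}
    (hω : ContinuousOn ω (total f ε r)) {c : Chain n n}
    (hc : c.IsSmoothIn (fibre f ε r t₀))
    (hhol : DifferentiableOn ℂ (c.leray Φ ω) (Metric.ball t₀ ρ)) {a : ℝ} (ha : 0 < a)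
    (haρ : a < ρ) :
    (c.tube Φ t₀ a).integral (fun x => (f x - t₀)⁻¹ • ω x) =
      2 * Real.pi * Complex.I * c.leray Φ ω t₀ := by
  set γ : ℝ → ℂ := fun τ => t₀ + a * Complex.exp (2 * Real.pi * Complex.I * (τ : ℂ)) with hγ
  have hγc : ContDiff ℝ 1 γ := contDiff_const.add (contDiff_const.mul
    ((contDiff_const.mul Complex.ofRealCLM.contDiff).cexp))
  have hγd : ∀ τ, deriv γ τ = 2 * Real.pi * Complex.I * (γ τ - t₀) := fun τ => by
    have h1 : HasDerivAt (fun τ : ℝ => 2 * Real.pi * Complex.I * (τ : ℂ))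
        (2 * Real.pi * Complex.I * 1) τ :=
      (Complex.ofRealCLM.hasDerivAt (x := τ)).const_mul _
    have h2 : HasDerivAt γ _ τ := (h1.cexp.const_mul (a : ℂ)).const_add t₀
    rw [h2.deriv, hγ]
    ring
  have hγcm : ∀ τ, γ τ = circleMap t₀ a (2 * Real.pi * τ) := fun τ => by
    simp only [hγ, circleMap]
    push_cast
    ring_nf
  have hγne : ∀ τ, γ τ - t₀ ≠ 0 := fun τ => by
    simp [hγ, ha.ne', Complex.exp_ne_zero]
  have hγm : ∀ τ ∈ Icc (0 : ℝ) 1, γ τ ∈ Metric.ball t₀ ρ := fun τ _ => by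
    rw [hγcm]
    exact Metric.closedBall_subset_ball haρ (circleMap_mem_closedBall t₀ ha.le _)
  have htube : c.tube Φ t₀ a = Finsupp.mapDomain (Cube.prism Φ γ) c := rfl
  rw [htube, hT.integral_chain_prism hf hω hc hγc hγm (h := fun z => (z - t₀)⁻¹)
    (ContinuousOn.inv₀ (hγc.continuous.continuousOn.sub continuousOn_const) fun τ _ => hγne τ)]
  -- On the circle `γ' / (γ - t₀)` is the constant `2πi`, so Cauchy's formula takes the form of the
  -- mean value property.
  have hmean : Real.circleAverage (c.leray Φ ω) t₀ a = c.leray Φ ω t₀ := by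
    refine DiffContOnCl.circleAverage (DifferentiableOn.diffContOnCl ?_)
    rw [closure_ball _ (by simpa using ha.ne'), abs_of_pos ha]
    exact hhol.mono (Metric.closedBall_subset_ball haρ)
  have hcv : ∫ τ in (0 : ℝ)..1, c.leray Φ ω (circleMap t₀ a (2 * Real.pi * τ)) =
      c.leray Φ ω t₀ := by
    rw [intervalIntegral.integral_comp_mul_left
      (fun θ => c.leray Φ ω (circleMap t₀ a θ)) Real.two_pi_pos.ne', ← hmean,
      Real.circleAverage_def]
    simp
  rw [← hcv, ← intervalIntegral.integral_const_mul]
  congr 1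
  funext τ
  rw [hγd, ← hγcm]
  field_simp [hγne τ]

/-- The Gelfand–Leray period over the central fibre does not depend on the trivialization. -/
theorem leray_base_eq {ρ' : ℝ} {Φ' : Space n → ℂ → Space n} {Ψ' : Space n → Space n}
    (hT : IsLocalTrivialization f ε r t₀ ρ Φ Ψ) (hT' : IsLocalTrivialization f ε r t₀ ρ' Φ' Ψ')
    (hf : IsGoodRepresentative f ε r) (ω : DiffForm n (n + 1)) {c : Chain n n}
    (hc : c.IsSmoothIn (fibre f ε r t₀)) :
    c.leray Φ ω t₀ = c.leray Φ' ω t₀ := by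
  refine Finset.sum_congr rfl fun σ hσ => ?_
  obtain ⟨hsm, hmem⟩ := hc σ hσ
  simp only [Cube.leray]
  congr 1
  refine setIntegral_congr_fun measurableSet_Icc fun y hy => ?_
  have hx := σ.extend_mem hmem y
  -- The map at parameter `t₀` is the identity only on the fibre, so its derivative is known only
  -- along tangent vectors of cubes in the fibre.
  have key : ∀ {ρ' : ℝ} {Φ' : Space n → ℂ → Space n} {Ψ' : Space n → Space n},
      IsLocalTrivialization f ε r t₀ ρ' Φ' Ψ' → ∀ v : Fin n → ℝ,
      familyFDeriv Φ' (σ.extend y, t₀) (fderivWithin ℝ σ.extend (Icc 0 1) y v, 0) =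
        fderivWithin ℝ σ.extend (Icc 0 1) y v := by
    intro ρ' Φ' Ψ' hT v
    have h1 := hT.hasFDerivWithinAt_slice hsm hmem (Metric.mem_ball_self hT.ρ_pos) hy
    have h2 : (fun y => Φ' (σ.extend y) t₀) = σ.extend :=
      funext fun z => hT.base _ (σ.extend_mem hmem z)
    rw [h2] at h1
    conv_rhs => rw [h1.fderivWithin (uniqueDiffOn_unitBox n y hy)]
    rfl
  have hb := hT.base _ hx
  have hb' := hT'.base _ hx
  have hw : ∀ i : Fin n, fderiv ℂ f (σ.extend y)
      (fderivWithin ℝ σ.extend (Icc 0 1) y (Pi.single i 1)) = 0 := fun i =>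
    fderiv_apply_eq_zero_of_mem_fibre hf hy (hsm.differentiableOn y hy).hasFDerivWithinAt
      (fun z _ => σ.extend_mem hmem z) _
  have hu := hT.fderiv_familyFDeriv_inr hf hx (Metric.mem_ball_self hT.ρ_pos) 1
  have hu' := hT'.fderiv_familyFDeriv_inr hf hx (Metric.mem_ball_self hT'.ρ_pos) 1
  rw [hb] at hu
  rw [hb'] at hu'
  simp only [Cube.lerayIntegrand, key hT, key hT', hb, hb']
  -- The two lifts of `1` differ by a vector in `ker df`, which `ω` does not see next to `n` further
  -- vertical vectors.
  rw [topForm_snoc_eq_mul (ω (σ.extend y)) hw hu' hu, one_mul]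

end IsLocalTrivialization

/-! ### Period integrals -/

theorem period_congr {n : ℕ} {f : Space n → ℂ} {Y : Set (Space n)}
    {Δ : Chain n (n + 1)} (hΔ : Δ.IsSmoothIn Y) {ω ω' : DiffForm n (n + 1)}
    (h : ∀ x ∈ Y, ω x = ω' x) (t : ℂ) : period f Δ ω t = period f Δ ω' t :=
  Chain.integral_congr fun σ hσ =>
    Cube.integral_congr (hΔ σ hσ).2 fun x hx => by rw [h x hx]

/-- Off `X_t` the form `ω / (f - t)` is holomorphic of top degree, hence closed, so `Δ` may be
replaced by the standard tube. Holomorphy of the residue integral is left as a hypothesis, to be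
supplied separately for `df ∧ η` and for `dη`. -/
theorem period_eq_leray {n : ℕ} {f : Space n → ℂ} {ε r : ℝ} (hf : IsGoodRepresentative f ε r)
    {t : ℂ} {ρ : ℝ} {Φ : Space n → ℂ → Space n} {Ψ : Space n → Space n}
    (hT : IsLocalTrivialization f ε r t ρ Φ Ψ) {a : ℝ} (ha : 0 < a) (haρ : a < ρ)
    {c : Chain n n} (hc : c.IsSmoothIn (fibre f ε r t)) {Δ : Chain n (n + 1)}
    (hΔ : Chain.Homologous (total f ε r \ fibre f ε r t) (c.tube Φ t a) Δ)
    {ω : DiffForm n (n + 1)} (hω : AnalyticOnNhd ℂ ω (total f ε r))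
    (hhol : DifferentiableOn ℂ (c.leray Φ ω) (Metric.ball t ρ)) :
    period f Δ ω t = 2 * Real.pi * Complex.I * c.leray Φ ω t := by
  rw [← hT.integral_tube hf hω.continuousOn hc hhol ha haρ, period]
  refine hΔ.integral_eq (fun x hx => ?_) fun σ _ _ => ?_
  · have hne : f x - t ≠ 0 := fun h => hx.2 ⟨hx.1, sub_eq_zero.1 h⟩
    exact (((hf.analytic_total x hx.1).sub analyticAt_const).inv hne).smul (hω x hx.1)
  · refine setIntegral_eq_zero_of_forall_eq_zero fun y _ => ?_
    rw [extDeriv_eq_zero_of_top]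
    rfl

theorem Chain.map_eq_self {n k : ℕ} {c : Chain n k} {Y : Set (Space n)} (hc : c.IsSmoothIn Y)
    {g : Space n → Space n} (hg : ∀ x ∈ Y, g x = x) : c.map g = c := by
  refine (Finsupp.mapDomain_congr (g := id) fun σ hσ => ?_).trans Finsupp.mapDomain_id
  funext y
  exact hg _ ((hc σ hσ).2 y)

/-- The period of `df ∧ η` over a tube is, up to a constant, the period of `η` over its core. -/
theorem period_dWedge {n : ℕ} {f : Space n → ℂ} {ε r : ℝ} (hf : IsGoodRepresentative f ε r)
    {t : ℂ} {c : Chain n n} (hc : c.IsSmoothIn (fibre f ε r t)) (hcyc : c.IsCycle)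
    {Δ : Chain n (n + 1)} (hΔ : IsTubeCycle f ε r t c Δ) {η : DiffForm n n}
    (hη : AnalyticOnNhd ℂ η (total f ε r)) :
    period f Δ (dWedge f η) t = 2 * Real.pi * Complex.I * ((-1) ^ n * c.integral η) := by
  obtain ⟨-, -, ρ, Φ, Ψ, a, hT, ha, haρ, hhom⟩ := hΔ
  rw [period_eq_leray hf hT ha haρ hc hhom (analyticOnNhd_dWedge hf.analytic_total hη)
    (hT.differentiableOn_leray_dWedge hf hη hc hcyc),
    hT.leray_dWedge hf η hc (Metric.mem_ball_self hT.ρ_pos), Chain.map_eq_self hc hT.base]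

end MilnorPeriod

end

theorem mainTheorem5 {n : ℕ} (f : MilnorPeriod.Space n → ℂ) (ε r : ℝ)
    (hf : MilnorPeriod.IsGoodRepresentative f ε r)
    (ω bω : MilnorPeriod.DiffForm n (n + 1))
    (hb : MilnorPeriod.IsBOf f (MilnorPeriod.total f ε r) ω bω)
    (W : Set ℂ) (hW : IsOpen W) (hWS : W ⊆ MilnorPeriod.puncturedDisc r)
    (δ : ℂ → MilnorPeriod.Chain n n) (hδ : MilnorPeriod.IsParallelFamily f ε r W δ)
    (Δ : ℂ → MilnorPeriod.Chain n (n + 1))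
    (hΔ : ∀ t ∈ W, MilnorPeriod.IsTubeCycle f ε r t (δ t) (Δ t)) :
    ∀ t ∈ W, HasDerivAt (fun s => MilnorPeriod.period f (Δ s) bω s)
      (MilnorPeriod.period f (Δ t) ω t) t := by
  intro t ht
  obtain ⟨η, hη, hωη⟩ := hb
  obtain ⟨hsm, hcyc⟩ := hδ.1 t ht
  -- Two trivializations over discs around `t` occur: `Φ` realizes the parallel transport of `δ`,
  -- while `Φ'` defines the tube. They are compared by `leray_base_eq`.
  obtain ⟨ρ, Φ, Ψ, hT, hhom⟩ := hδ.2 t ht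
  obtain ⟨hΔsm, -, ρ', Φ', Ψ', a, hT', ha, haρ, hΔhom⟩ := hΔ t ht
  have hd := ((hT.hasDerivAt_integral_map hf hη hsm hcyc
    (Metric.mem_ball_self hT.ρ_pos)).const_mul ((-1) ^ n)).const_mul (2 * Real.pi * Complex.I)
  have hval : MilnorPeriod.period f (Δ t) ω t =
      2 * Real.pi * Complex.I * ((-1) ^ n * ((-1) ^ n * (δ t).leray Φ (extDeriv η) t)) := by
    rw [MilnorPeriod.period_congr hΔsm (fun x hx => (hωη x hx.1).1),
      MilnorPeriod.period_eq_leray hf hT' ha haρ hsm hΔhom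
        (MilnorPeriod.analyticOnNhd_extDeriv hη)
        (hT'.differentiableOn_leray_extDeriv hf hη hsm hcyc),
      hT'.leray_base_eq hT hf _ hsm, ← mul_assoc ((-1 : ℂ) ^ n), ← mul_pow]
    simp
  rw [hval]
  refine hd.congr_of_eventuallyEq ?_
  -- For `s` near `t` the tube at `s` may use its own trivialization, but the period is always `2πi
  -- (-1)^n ∫_{δ(s)} η`. Since `δ(s)` is homologous in `X_s` to the transport of `δ(t)`, this is the
  -- function differentiated in `hd`.
  filter_upwards [hW.mem_nhds ht, Metric.ball_mem_nhds t hT.ρ_pos] with s hsW hsρ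
  rw [MilnorPeriod.period_congr (hΔ s hsW).1 (fun x hx => (hωη x hx.1).2),
    MilnorPeriod.period_dWedge hf (hδ.1 s hsW).1 (hδ.1 s hsW).2 (hΔ s hsW) hη,
    (hhom s ⟨hsρ, hsW⟩).integral_eq (hη.mono fun x hx => hx.1) fun σ hσ hσm =>
      MilnorPeriod.Cube.integral_extDeriv_eq_zero_of_mem_fibre hf (hT.ne_zero hsρ) hσ hσm _]
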